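/- Let $n\ge 1$, $\mu\ge 2$ and $\kappa=\frac{\mu-2}{2}$. For $\xi\in\mathbb R^n$ put $\langle\xi\rangle=\sqrt{1+|\xi|^2}$ and $[\xi]=|\xi|/\langle\xi\rangle$, and let $m(\mathrm D)$ be the Fourier multiplier with symbol $m(\xi)$, normalized so that $-\Delta=|\mathrm D|^2$. Consider the Cauchy problem $$u_{tt}-\Delta u+\frac{\mu}{1+t}u_t=0\quad (t\ge 0,\ x\in\mathbb R^n),\qquad u(0)=u_1,\quad u_t(0)=u_2,$$ with solutions $u\in C^1([0,\infty),L^2(\mathbb R^n))\cap C([0,\infty),H^1(\mathbb R^n))$. For $f\in L^2(\mathbb R^n)^2$ let $(u_1,u_2)$ be the data with $(\langle \mathrm D\rangle u_1,u_2)^T=[\mathrm D]^\kappa f$, let $u$ be the corresponding solution, and put $\mathbb E^{(\kappa)}(t)f=(|\mathrm D|u(t),u_t(t))^T$. Let $\mathcal E_0(t)$ be the multiplier with symbol $\begin{pmatrix}\cos t|\xi|&\sin t|\xi|\\-\sin t|\xi|&\cos t|\xi|\end{pmatrix}$ and let $$Z_+=\operatorname*{s-lim}_{t\to\infty}(1+t)^{\mu/2}\,\mathcal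 E_0(-t)\,\mathbb E^{(\kappa)}(t)$$ be the strong limit of these bounded operators on $L^2(\mathbb R^n)^2$. Then $Z_+$ exists and is unique, it is a matrix Fourier multiplier whose symbol $Z_+(\xi)$ can be taken continuous on $\mathbb R^n\setminus\{0\}$ (which determines it there), and $$\lim_{|\xi|\to\infty}Z_+(\xi)=I .$$ Consequently $Z_+$ almost preserves high frequencies: for every $\varepsilon>0$ there is an $R$ such that $\|Z_+f-f\|\le\varepsilon\|f\|$ for all $f=(f_1,f_2)\in L^2(\mathbb R^n)^2$ whose Fourier transform vanishes for $|\xi|<R$, where $\|f\|=\max_j\|f_j\|_{L^2}$. For $\mu=2$ one has, exactly, $$Z_+(\xi)=\begin{pmatrix}[\xi]&0\\ \langle\xi\rangle^{-1}&1\end{pmatrix}\qquad(\xi\ne0).$$ -/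

import Mathlib

open MeasureTheory Filter Topology
open scoped FourierTransform SchwartzMap Laplacian

noncomputable section

namespace DissipativeWave

/-- The space `ℝⁿ` with its Euclidean norm. -/
abbrev Space (n : ℕ) := EuclideanSpace ℝ (Fin n)

/-- The complex space `L²(ℝⁿ)`. -/
abbrev L2 (n : ℕ) := Lp (α := Space n) ℂ 2

/-- Pairs of functions in `L²(ℝⁿ)`, indexed by `0` and `1`. -/
abbrev Pair (n : ℕ) := Fin 2 → L2 n

/-- The Japanese bracket `⟨ξ⟩ = √(1 + |ξ|²)`. -/
def japanese {n : ℕ} (ξ : Space n) : ℝ := Real.sqrt (1 + ‖ξ‖ ^ 2)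

/-- The symbol `[ξ] = |ξ| / ⟨ξ⟩`. -/
def bracket {n : ℕ} (ξ : Space n) : ℝ := ‖ξ‖ / japanese ξ

/-- `f` is in the domain of the Fourier multiplier `m(D)` in `L²` and `g = m(D) f`. Symbols are
functions of the angular frequency `ξ`, for which `Δ` has the symbol `-|ξ|²`. Mathlib's Fourier
transform has the kernel `exp (-2πi x·η)`, so that `ξ = 2πη`. -/
def IsMultiplier {n : ℕ} (m : Space n → ℝ) (f g : L2 n) : Prop :=
  ∀ᵐ η : Space n, (𝓕 g : L2 n) η = (m ((2 * Real.pi) • η) : ℂ) * (𝓕 f : L2 n) η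

/-- The bounded operator `T` on pairs is the matrix Fourier multiplier with symbol `M`. -/
def HasSymbol {n : ℕ} (T : Pair n →L[ℂ] Pair n)
    (M : Space n → Matrix (Fin 2) (Fin 2) ℂ) : Prop :=
  ∀ (f : Pair n) (i : Fin 2), ∀ᵐ η : Space n,
    (𝓕 (T f i) : L2 n) η = ∑ j, M ((2 * Real.pi) • η) i j * (𝓕 (f j) : L2 n) η

/-- `u` is the solution, with time derivative `v`, of the Cauchy problem
`u_tt - Δ u + μ / (1 + t) u_t = 0`, `u(0) = u₁`, `u_t(0) = u₂`, in the space
`C¹([0, ∞), L²) ∩ C([0, ∞), H¹)`; the equation holds in the sense of tempered distributions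
in the space variable. Only the values at `t ≥ 0` matter. -/
structure IsSolution {n : ℕ} (μ : ℝ) (u₁ u₂ : L2 n) (u v : ℝ → L2 n) : Prop where
  /-- `u` is continuous with values in `H¹`, that is, `⟨D⟩ u` is continuous with values in `L²`. -/
  continuous_H1 : ∃ w : ℝ → L2 n, ContinuousOn w (Set.Ici 0) ∧
    ∀ t, 0 ≤ t → IsMultiplier japanese (u t) (w t)
  hasDeriv : ∀ t, 0 ≤ t → HasDerivWithinAt u (v t) (Set.Ici 0) t
  continuous_deriv : ContinuousOn v (Set.Ici 0)
  equation : ∀ (φ : 𝓢(Space n, ℂ)) (t : ℝ), 0 ≤ t →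
    HasDerivWithinAt (fun s => (v s : 𝓢'(Space n, ℂ)) φ)
      ((Δ (u t : 𝓢'(Space n, ℂ))) φ - ((μ / (1 + t) : ℝ) : ℂ) * (v t : 𝓢'(Space n, ℂ)) φ)
      (Set.Ici 0) t
  initial_value : u 0 = u₁
  initial_deriv : v 0 = u₂

/-- The Cauchy data `(u₁, u₂)` satisfy `(⟨D⟩ u₁, u₂) = [D]^κ f` with `f ∈ L² × L²`; here `f`
represents `(⟨D⟩ u₁, u₂) ∈ [D]^κ L²` under the canonical isometry `[D]^κ : L² → [D]^κ L²`. -/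
def IsData {n : ℕ} (κ : ℝ) (f : Pair n) (u₁ u₂ : L2 n) : Prop :=
  (∃ g : L2 n, IsMultiplier japanese u₁ g ∧ IsMultiplier (fun ξ => bracket ξ ^ κ) (f 0) g) ∧
    IsMultiplier (fun ξ => bracket ξ ^ κ) (f 1) u₂

/-- `S` is the energy operator `𝔼^(κ)(t)`, which maps `(⟨D⟩ u₁, u₂) ∈ [D]^κ L²`, identified with
an element of `L² × L²`, to `(|D| u(t), u_t(t))`, where `u` solves the Cauchy problem. -/
def IsEnergyOperator {n : ℕ} (μ κ t : ℝ) (S : Pair n →L[ℂ] Pair n) : Prop :=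
  ∀ f : Pair n, ∃ u₁ u₂ : L2 n, IsData κ f u₁ u₂ ∧ (∃ u v, IsSolution μ u₁ u₂ u v) ∧
    ∀ u v, IsSolution μ u₁ u₂ u v → IsMultiplier (fun ξ => ‖ξ‖) (u t) (S f 0) ∧ S f 1 = v t

/-- The symbol of the unitary evolution `ℰ₀(t)` of free waves in the energy space. -/
def freeSymbol {n : ℕ} (t : ℝ) (ξ : Space n) : Matrix (Fin 2) (Fin 2) ℂ :=
  !![(Real.cos (t * ‖ξ‖) : ℂ), (Real.sin (t * ‖ξ‖) : ℂ);
     -(Real.sin (t * ‖ξ‖) : ℂ), (Real.cos (t * ‖ξ‖) : ℂ)]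

/-- `Z` is the operator `Z₊ = s-lim_{t → ∞} (1 + t)^{μ/2} ℰ₀(-t) 𝔼^(κ)(t)`, `κ = (μ - 2) / 2`,
from `[D]^κ L²` (identified with `L²`) to `L²`. -/
def IsZPlus {n : ℕ} (μ : ℝ) (Z : Pair n →L[ℂ] Pair n) : Prop :=
  ∃ S U : ℝ → (Pair n →L[ℂ] Pair n),
    (∀ t, 0 ≤ t → IsEnergyOperator μ ((μ - 2) / 2) t (S t)) ∧
    (∀ t, HasSymbol (U t) (freeSymbol t)) ∧
    ∀ f, Tendsto (fun t : ℝ => (((1 + t) ^ (μ / 2) : ℝ) : ℂ) • U (-t) (S t f)) atTop (𝓝 (Z f))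

end DissipativeWave

end

/-! The Fourier transform in x reduces the Cauchy problem to damped oscillators y'' + r² y + μ/(1+t)
y' = 0 with r = |ξ| > 0. With a = μ/2, the substitution y(t) = (1+t)^(-a) W(r(1+t)) turns all of
them into the single equation W'' + (1 - a(a-1)/s²) W = 0. Its potential is integrable at infinity,
so (W, W') converges in coordinates rotating with the free solutions. Hence (1+t)^(μ/2) times the
energy vector, with the free evolution undone, has a limit at every frequency (`tendsto_wave`).

The time t = 0 corresponds to s = r, so the map from the data to the limit feels the potential only
on (r, ∞), where its integral is O(1/r). This map therefore tends to the identity as r → ∞, and for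
μ = 2 it is the identity because the potential vanishes (`tendsto_scatteringSymbol`,
`scatteringSymbol_eq_one`). The remaining factors in the symbol come from the passage from f to the
data and from y' to the derivative of (1+t)^a y.

Strong convergence in L² follows by dominated convergence, which needs a bound uniform in t and r.
Low frequencies are the difficulty, and `exists_uniform_bound` splits at r(1+t) = 1. Before that
time a weighted energy loses at most (1+t)^(a-1) ≤ r^(-(a-1)), which is what the weight [D]^κ, κ =
a-1, compensates. Afterwards the energy W² + W'² is conserved up to a constant factor.

The energy operator speaks about every solution in the stated class. Existence (`exists_isSolution`)
comes from superposing fundamental solutions, uniqueness (`IsSolution.unique`) from testing with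
band-limited functions. -/

noncomputable section

namespace DissipativeWave

/-! ### Linear differential equations with continuous coefficients -/

section LinearODE

variable {E : Type*} [NormedAddCommGroup E] [NormedSpace ℝ E]

/-- The iterated integrals whose sum is the solution of `x' = A x`, `x(0) = x₀`. -/
def dysonTerm (A : ℝ → E →L[ℝ] E) (x₀ : E) : ℕ → ℝ → E
  | 0, _ => x₀
  | k + 1, t => ∫ s in (0 : ℝ)..t, A s (dysonTerm A x₀ k s)

variable {A : ℝ → E →L[ℝ] E}

lemma continuous_dysonTerm (hA : Continuous A) (x₀ : E) (k : ℕ) :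
    Continuous (dysonTerm A x₀ k) := by
  induction k with
  | zero => exact continuous_const
  | succ k ih =>
    exact intervalIntegral.continuous_primitive
      (fun a b => (hA.clm_apply ih).intervalIntegrable a b) 0

/-- Each integration raises the power of |t| by one and so produces the factorial. Absolute values
cover both directions of time. -/
lemma norm_dysonTerm_le (hA : Continuous A) (x₀ : E) {K T : ℝ} (hK0 : 0 ≤ K)
    (hK : ∀ t, |t| ≤ T → ‖A t‖ ≤ K) (k : ℕ) {t : ℝ} (ht : |t| ≤ T) :
    ‖dysonTerm A x₀ k t‖ ≤ (K * |t|) ^ k / k.factorial * ‖x₀‖ := by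
  induction k generalizing t with
  | zero => simp [dysonTerm]
  | succ k ih =>
    have hfac : (0 : ℝ) < k.factorial := by positivity
    have h1 : ‖dysonTerm A x₀ (k + 1) t‖ ≤
        ∫ s in Set.uIoc 0 t, K ^ (k + 1) / k.factorial * ‖x₀‖ * |s - 0| ^ k := by
      refine (intervalIntegral.norm_integral_le_integral_norm_uIoc).trans ?_
      refine setIntegral_mono_on ?_ ?_ measurableSet_uIoc ?_
      · exact ((hA.clm_apply (continuous_dysonTerm hA x₀ k)).norm.intervalIntegrable 0 t).def'
      · exact (Continuous.intervalIntegrable (by fun_prop) 0 t).def'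
      · intro s hs
        have hs' : |s| ≤ T := by
          refine le_trans ?_ ht
          rcases Set.mem_uIoc.1 hs with h | h
          · rw [abs_of_pos h.1, abs_of_pos (h.1.trans_le h.2)]; exact h.2
          · rw [abs_of_nonpos h.2, abs_of_neg (h.1.trans_le h.2)]; linarith [h.1]
        calc ‖A s (dysonTerm A x₀ k s)‖ ≤ ‖A s‖ * ‖dysonTerm A x₀ k s‖ :=
              (A s).le_opNorm _
          _ ≤ K * ((K * |s|) ^ k / k.factorial * ‖x₀‖) := by
              gcongr
              · exact hK s hs'
              · exact ih hs'
          _ = _ := by rw [sub_zero]; ring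
    refine h1.trans (le_of_eq ?_)
    rw [integral_const_mul, integral_pow_abs_sub_uIoc, sub_zero, Nat.factorial_succ]
    push_cast
    field_simp
    ring

/-- Linear differential equations with continuous coefficients have global solutions. -/
theorem exists_hasDerivAt_linear [CompleteSpace E] (hA : Continuous A) (x₀ : E) :
    ∃ x : ℝ → E, x 0 = x₀ ∧ ∀ t, HasDerivAt x (A t (x t)) t := by
  have hbound : ∀ T : ℝ, ∃ K, 0 ≤ K ∧ ∀ t, |t| ≤ T → ‖A t‖ ≤ K := by
    intro T
    obtain ⟨K, hK⟩ := (isCompact_Icc (a := -T) (b := T)).exists_bound_of_continuousOn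
      hA.continuousOn
    exact ⟨max K 0, le_max_right _ _, fun t ht => (hK t (abs_le.1 ht)).trans (le_max_left _ _)⟩
  have hd : ∀ k t, HasDerivAt (dysonTerm A x₀ (k + 1)) (A t (dysonTerm A x₀ k t)) t := by
    intro k t
    have hc : Continuous fun s => A s (dysonTerm A x₀ k s) :=
      hA.clm_apply (continuous_dysonTerm hA x₀ k)
    exact intervalIntegral.integral_hasDerivAt_right (hc.intervalIntegrable _ _)
      (hc.stronglyMeasurableAtFilter _ _) hc.continuousAt
  have hsumm : ∀ t, Summable fun k => dysonTerm A x₀ k t := by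
    intro t
    obtain ⟨K, hK0, hK⟩ := hbound |t|
    exact Summable.of_norm_bounded ((Real.summable_pow_div_factorial (K * |t|)).mul_right _)
      (fun k => norm_dysonTerm_le hA x₀ hK0 hK k le_rfl)
  have hzero : ∀ k, dysonTerm A x₀ (k + 1) 0 = 0 := fun k => by simp [dysonTerm]
  refine ⟨fun t => ∑' k, dysonTerm A x₀ k t, ?_, fun t => ?_⟩
  · change ∑' k, dysonTerm A x₀ k 0 = x₀
    rw [(hsumm 0).tsum_eq_zero_add]
    simp [dysonTerm]
  · have hsplit : (fun t => ∑' k, dysonTerm A x₀ k t) =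
        fun t => x₀ + ∑' k, dysonTerm A x₀ (k + 1) t := by
      funext t
      rw [(hsumm t).tsum_eq_zero_add]
      rfl
    -- Termwise differentiation takes place on a bounded open interval containing 0 and t, where one
    -- constant K dominates the whole series. The constant term is split off because term k + 1
    -- differentiates to `A` applied to term k.
    obtain ⟨K, hK0, hK⟩ := hbound (|t| + 1)
    have hder := hasDerivAt_tsum_of_isPreconnected
      (g := fun k t => dysonTerm A x₀ (k + 1) t)
      (g' := fun k t => A t (dysonTerm A x₀ k t))
      (u := fun k => K * ((K * (|t| + 1)) ^ k / k.factorial * ‖x₀‖))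
      (t := Set.Ioo (-(|t| + 1)) (|t| + 1)) (y₀ := 0) (y := t)
      (((Real.summable_pow_div_factorial _).mul_right _).mul_left _)
      isOpen_Ioo isPreconnected_Ioo (fun k s _ => hd k s) ?_ ?_ ?_ ?_
    · have : A t (∑' k, dysonTerm A x₀ k t) = ∑' k, A t (dysonTerm A x₀ k t) :=
        (A t).map_tsum (hsumm t)
      simp only [this]
      rw [hsplit]
      exact hder.const_add x₀
    · intro k s hs
      have hs' : |s| ≤ |t| + 1 := (abs_lt.2 hs).le
      calc ‖A s (dysonTerm A x₀ k s)‖ ≤ ‖A s‖ * ‖dysonTerm A x₀ k s‖ := (A s).le_opNorm _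
        _ ≤ K * ((K * |s|) ^ k / k.factorial * ‖x₀‖) := by
            gcongr
            · exact hK s hs'
            · exact norm_dysonTerm_le hA x₀ hK0 hK k hs'
        _ ≤ _ := by gcongr
    · constructor <;> linarith [abs_nonneg t]
    · simp [hzero]
    · exact abs_lt.1 (lt_add_one _)

end LinearODE

/-! ### The Bessel-type equation on the half line -/

/-- `W` solves `W'' + (1 - c / s²) W = 0` on `(0, ∞)` and has the derivative `W'`. -/
structure IsBesselSolution (c : ℝ) (W W' : ℝ → ℝ) : Prop where
  measurable : Measurable W
  measurable_deriv : Measurable W'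
  hasDerivAt : ∀ s, 0 < s → HasDerivAt W (W' s) s
  hasDerivAt_deriv : ∀ s, 0 < s → HasDerivAt W' ((c / s ^ 2 - 1) * W s) s

/-- The substitution s = exp τ moves the singularity at s = 0 to τ = -∞ and leaves a linear system
with continuous coefficients on ℝ. The point s = 1 becomes τ = 0. -/
theorem exists_isBesselSolution (c w₀ w₁ : ℝ) :
    ∃ W W' : ℝ → ℝ, IsBesselSolution c W W' ∧ W 1 = w₀ ∧ W' 1 = w₁ := by
  let T₁ : ℝ × ℝ →L[ℝ] ℝ × ℝ := (ContinuousLinearMap.snd ℝ ℝ ℝ).prod 0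
  let T₂ : ℝ × ℝ →L[ℝ] ℝ × ℝ :=
    ContinuousLinearMap.prod 0 (ContinuousLinearMap.fst ℝ ℝ ℝ)
  obtain ⟨x, hx0, hx⟩ := exists_hasDerivAt_linear
    (A := fun τ : ℝ => Real.exp τ • T₁ + (c * Real.exp (-τ) - Real.exp τ) • T₂)
    (by fun_prop) (w₀, w₁)
  have hxc : Continuous x := continuous_iff_continuousAt.2 fun t => (hx t).continuousAt
  refine ⟨fun s => (x (Real.log s)).1, fun s => (x (Real.log s)).2, ⟨?_, ?_, ?_, ?_⟩, ?_, ?_⟩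
  · exact (measurable_fst.comp hxc.measurable).comp Real.measurable_log
  · exact (measurable_snd.comp hxc.measurable).comp Real.measurable_log
  · intro s hs
    have h1 := (hx (Real.log s)).scomp s (Real.hasDerivAt_log hs.ne')
    have h2 := (ContinuousLinearMap.fst ℝ ℝ ℝ).hasFDerivAt.comp_hasDerivAt s h1
    refine h2.congr_deriv ?_
    simp [T₁, T₂, Real.exp_log hs]
    field_simp
  · intro s hs
    have h1 := (hx (Real.log s)).scomp s (Real.hasDerivAt_log hs.ne')
    have h2 := (ContinuousLinearMap.snd ℝ ℝ ℝ).hasFDerivAt.comp_hasDerivAt s h1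
    refine h2.congr_deriv ?_
    simp [T₁, T₂, Real.exp_log hs, Real.exp_neg]
    field_simp
  · simp [hx0]
  · simp [hx0]

namespace IsBesselSolution

variable {c : ℝ} {W W' : ℝ → ℝ}

lemma continuousOn (h : IsBesselSolution c W W') : ContinuousOn W (Set.Ioi 0) :=
  fun s hs => (h.hasDerivAt s hs).continuousAt.continuousWithinAt

lemma continuousOn_deriv (h : IsBesselSolution c W W') : ContinuousOn W' (Set.Ioi 0) :=
  fun s hs => (h.hasDerivAt_deriv s hs).continuousAt.continuousWithinAt

/-- The quantity `(W² + W'²) exp (c / s)` decreases. -/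
lemma sq_add_sq_le (h : IsBesselSolution c W W') (hc : 0 ≤ c) {s₀ s : ℝ} (h1 : 1 ≤ s₀)
    (hs : s₀ ≤ s) : W s ^ 2 + W' s ^ 2 ≤ Real.exp c * (W s₀ ^ 2 + W' s₀ ^ 2) := by
  have hanti : AntitoneOn (fun s => (W s ^ 2 + W' s ^ 2) * Real.exp (c * s⁻¹))
      (Set.Ioi 0) := by
    refine antitoneOn_of_hasDerivWithinAt_nonpos (convex_Ioi 0)
      (f' := fun s => (2 * W s * W' s + 2 * W' s * ((c / s ^ 2 - 1) * W s)) *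
        Real.exp (c * s⁻¹) + (W s ^ 2 + W' s ^ 2) *
        (Real.exp (c * s⁻¹) * (c * (-(s ^ 2)⁻¹)))) ?_ ?_ ?_
    · intro s hs
      have := h.continuousOn s hs
      have := h.continuousOn_deriv s hs
      have : s ≠ 0 := ne_of_gt hs
      refine ContinuousWithinAt.mul (by fun_prop) ?_
      refine Real.continuous_exp.continuousAt.comp_continuousWithinAt ?_
      exact (continuousAt_const.mul (continuousAt_inv₀ this)).continuousWithinAt
    · intro s hs
      rw [interior_Ioi] at hs
      have hs0 : s ≠ 0 := ne_of_gt hs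
      have e1 := ((h.hasDerivAt s hs).pow 2).add ((h.hasDerivAt_deriv s hs).pow 2)
      have e2 := ((hasDerivAt_inv hs0).const_mul c).exp
      refine ((e1.mul e2).congr_deriv ?_).hasDerivWithinAt
      simp
    · intro s hs
      rw [interior_Ioi] at hs
      have hs0 : 0 < s := hs
      -- Since (W² + W'²)' = 2c W W' / s², the weight completes the derivative to minus a square.
      have : (2 * W s * W' s + 2 * W' s * ((c / s ^ 2 - 1) * W s)) *
        Real.exp (c * s⁻¹) + (W s ^ 2 + W' s ^ 2) *
        (Real.exp (c * s⁻¹) * (c * (-(s ^ 2)⁻¹))) =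
        -(c / s ^ 2 * (W s - W' s) ^ 2 * Real.exp (c * s⁻¹)) := by
        field_simp
        ring
      rw [this, neg_nonpos]
      positivity
  have h0 : 0 < s₀ := by linarith
  have h2 := hanti (Set.mem_Ioi.2 h0) (Set.mem_Ioi.2 (h0.trans_le hs)) hs
  simp only at h2
  have h3 : 1 ≤ Real.exp (c * s⁻¹) := by
    rw [← Real.exp_zero]
    have : 0 < s := h0.trans_le hs
    exact Real.exp_le_exp.2 (by positivity)
  have h4 : Real.exp (c * s₀⁻¹) ≤ Real.exp c := by
    apply Real.exp_le_exp.2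
    exact mul_le_of_le_one_right hc (inv_le_one_of_one_le₀ h1)
  calc W s ^ 2 + W' s ^ 2 ≤ (W s ^ 2 + W' s ^ 2) * Real.exp (c * s⁻¹) :=
        le_mul_of_one_le_right (by positivity) h3
    _ ≤ _ := h2
    _ ≤ (W s₀ ^ 2 + W' s₀ ^ 2) * Real.exp c := by gcongr
    _ = _ := by ring

/-- The solution in coordinates rotating with the free solutions. -/
lemma hasDerivAt_rotated (h : IsBesselSolution c W W') {s : ℝ} (hs : 0 < s) :
    HasDerivAt (fun s => Real.cos s * W s - Real.sin s * W' s)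
      (-(Real.sin s * (c / s ^ 2 * W s))) s ∧
    HasDerivAt (fun s => Real.sin s * W s + Real.cos s * W' s)
      (Real.cos s * (c / s ^ 2 * W s)) s := by
  have h1 := h.hasDerivAt s hs
  have h2 := h.hasDerivAt_deriv s hs
  constructor
  · refine (((Real.hasDerivAt_cos s).mul h1).sub ((Real.hasDerivAt_sin s).mul h2)).congr_deriv ?_
    ring
  · refine (((Real.hasDerivAt_sin s).mul h1).add ((Real.hasDerivAt_cos s).mul h2)).congr_deriv ?_
    ring

lemma exists_bound (h : IsBesselSolution c W W') (hc : 0 ≤ c) :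
    ∃ C, ∀ s, 1 ≤ s → |W s| ≤ C ∧ |W' s| ≤ C := by
  refine ⟨Real.sqrt (Real.exp c * (W 1 ^ 2 + W' 1 ^ 2)), fun s hs => ?_⟩
  have := h.sq_add_sq_le hc le_rfl hs
  exact ⟨Real.abs_le_sqrt (by nlinarith [sq_nonneg (W' s)]),
    Real.abs_le_sqrt (by nlinarith [sq_nonneg (W s)])⟩

/-- The rotating coordinates have derivatives O(1/s²), because W is bounded on [1, ∞), and an
integrable derivative forces a limit. -/
lemma exists_tendsto_rotated (h : IsBesselSolution c W W') (hc : 0 ≤ c) :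
    ∃ p q : ℝ, Tendsto (fun s => Real.cos s * W s - Real.sin s * W' s) atTop (𝓝 p) ∧
      Tendsto (fun s => Real.sin s * W s + Real.cos s * W' s) atTop (𝓝 q) := by
  obtain ⟨C, hC⟩ := h.exists_bound hc
  have key : ∀ (g F : ℝ → ℝ), Continuous g → (∀ s, |g s| ≤ 1) →
      (∀ s ∈ Set.Ioi (1 : ℝ), HasDerivAt F (g s * (c / s ^ 2 * W s)) s) →
      ∃ p, Tendsto F atTop (𝓝 p) := by
    intro g F hg hg1 hF
    refine ⟨_, tendsto_limUnder_of_hasDerivAt_of_integrableOn_Ioi hF ?_⟩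
    have hint : IntegrableOn (fun s : ℝ => c * C * s ^ (-2 : ℝ)) (Set.Ioi 1) :=
      (integrableOn_Ioi_rpow_of_lt (by norm_num) one_pos).const_mul _
    refine hint.mono' ?_ ?_
    · refine ContinuousOn.aestronglyMeasurable ?_ measurableSet_Ioi
      refine hg.continuousOn.mul (ContinuousOn.mul ?_ (h.continuousOn.mono ?_))
      · refine continuousOn_const.div (by fun_prop) fun s hs => ?_
        have : (1 : ℝ) < s := hs
        positivity
      · exact Set.Ioi_subset_Ioi zero_le_one
    · refine (ae_restrict_mem measurableSet_Ioi).mono fun s hs => ?_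
      have hs1 : (1 : ℝ) < s := hs
      have hs0 : 0 < s := by linarith
      rw [norm_mul, Real.norm_eq_abs, Real.norm_eq_abs, abs_mul,
        abs_of_nonneg (by positivity : 0 ≤ c / s ^ 2), Real.rpow_neg hs0.le, Real.rpow_two]
      calc |g s| * (c / s ^ 2 * |W s|) ≤ 1 * (c / s ^ 2 * C) := by
            gcongr
            · exact hg1 s
            · exact (hC s hs1.le).1
        _ = _ := by ring
  obtain ⟨p, hp⟩ := key (fun s => -Real.sin s) _ (by fun_prop)
    (fun s => by rw [abs_neg]; exact Real.abs_sin_le_one s)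
    (fun s hs => ((h.hasDerivAt_rotated (zero_lt_one.trans hs)).1).congr_deriv (by ring))
  obtain ⟨q, hq⟩ := key Real.cos _ Real.continuous_cos Real.abs_cos_le_one
    (fun s hs => (h.hasDerivAt_rotated (zero_lt_one.trans hs)).2)
  exact ⟨p, q, hp, hq⟩

lemma wronskian_eq {V V' : ℝ → ℝ} (h : IsBesselSolution c W W') (h' : IsBesselSolution c V V')
    {s : ℝ} (hs : 0 < s) : W s * V' s - V s * W' s = W 1 * V' 1 - V 1 * W' 1 := by
  have hd : ∀ s ∈ Set.Ioi (0 : ℝ),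
      HasDerivAt (fun s => W s * V' s - V s * W' s) 0 s := fun s hs =>
    (((h.hasDerivAt s hs).mul (h'.hasDerivAt_deriv s hs)).sub
      ((h'.hasDerivAt s hs).mul (h.hasDerivAt_deriv s hs))).congr_deriv (by ring)
  exact isOpen_Ioi.is_const_of_deriv_eq_zero isPreconnected_Ioi
    (fun s hs => (hd s hs).differentiableAt.differentiableWithinAt)
    (fun s hs => (hd s hs).deriv) hs (Set.mem_Ioi.2 one_pos)

end IsBesselSolution

namespace IsBesselSolution

variable {c : ℝ} {W W' V V' : ℝ → ℝ}

lemma lincomb (h : IsBesselSolution c W W') (h' : IsBesselSolution c V V') (α β : ℝ) :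
    IsBesselSolution c (fun s => α * W s + β * V s) (fun s => α * W' s + β * V' s) where
  measurable := (h.measurable.const_mul α).add (h'.measurable.const_mul β)
  measurable_deriv := (h.measurable_deriv.const_mul α).add (h'.measurable_deriv.const_mul β)
  hasDerivAt s hs := ((h.hasDerivAt s hs).const_mul α).add ((h'.hasDerivAt s hs).const_mul β)
  hasDerivAt_deriv s hs :=
    (((h.hasDerivAt_deriv s hs).const_mul α).add
      ((h'.hasDerivAt_deriv s hs).const_mul β)).congr_deriv (by ring)

end IsBesselSolution

/-! ### Energy estimates for the damped oscillator at one frequency -/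

/-- `y` with derivative `y'` solves the dissipative wave equation at the frequency `r`. -/
structure IsWave (μ r : ℝ) (y y' : ℝ → ℝ) : Prop where
  hasDerivAt : ∀ t, 0 ≤ t → HasDerivAt y (y' t) t
  hasDerivAt_deriv : ∀ t, 0 ≤ t → HasDerivAt y' (-(r ^ 2 * y t) - μ / (1 + t) * y' t) t

namespace IsWave

variable {μ r : ℝ} {y y' : ℝ → ℝ}

/-- A function with nonpositive derivative on `[0, ∞)` is bounded by its initial value. -/
lemma _root_.DissipativeWave.le_initial_of_deriv_nonpos {F F' : ℝ → ℝ}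
    (hF : ∀ t, 0 ≤ t → HasDerivAt F (F' t) t) (hF' : ∀ t, 0 ≤ t → F' t ≤ 0) {t : ℝ}
    (ht : 0 ≤ t) : F t ≤ F 0 := by
  refine antitoneOn_of_hasDerivWithinAt_nonpos (convex_Ici 0) (f' := F')
    (fun t ht => (hF t ht).continuousAt.continuousWithinAt) ?_ ?_
    (Set.mem_Ici.2 le_rfl) (Set.mem_Ici.2 ht) ht
  · exact fun t ht => (hF t (interior_subset ht)).hasDerivWithinAt
  · exact fun t ht => hF' t (interior_subset ht)

lemma energy_le (h : IsWave μ r y y') (hμ : 0 ≤ μ) {t : ℝ} (ht : 0 ≤ t) :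
    (r * y t) ^ 2 + y' t ^ 2 ≤ (r * y 0) ^ 2 + y' 0 ^ 2 := by
  refine le_initial_of_deriv_nonpos (F := fun t => (r * y t) ^ 2 + y' t ^ 2)
    (F' := fun t => -(2 * (μ / (1 + t)) * y' t ^ 2)) (fun t ht => ?_) (fun t ht => ?_) ht
  · refine ((((h.hasDerivAt t ht).const_mul r).pow 2).add
      ((h.hasDerivAt_deriv t ht).pow 2)).congr_deriv ?_
    simp
    ring
  · have : 0 < 1 + t := by linarith
    have : 0 ≤ 2 * (μ / (1 + t)) * y' t ^ 2 := by positivity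
    linarith

/-- The weighted energy which controls low frequencies. -/
lemma weighted_energy_le (h : IsWave μ r y y') (hμ : 2 ≤ μ) {t : ℝ} (ht : 0 ≤ t) :
    ((1 + t) * (r * y t)) ^ 2 + ((1 + t) * y' t + y t) ^ 2 + (μ - 2) * y t ^ 2 ≤
      (r * y 0) ^ 2 + (y' 0 + y 0) ^ 2 + (μ - 2) * y 0 ^ 2 := by
  -- All terms of the derivative cancel except the one in y'²; its sign is where μ ≥ 2 enters.
  have := le_initial_of_deriv_nonpos (F := fun t => ((1 + t) * (r * y t)) ^ 2 +
      ((1 + t) * y' t + y t) ^ 2 + (μ - 2) * y t ^ 2)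
    (F' := fun t => -(2 * (μ - 2) * (1 + t) * y' t ^ 2)) (fun t ht => ?_) (fun t ht => ?_) ht
  · simpa using this
  · have h0 : 1 + t ≠ 0 := by linarith
    have hx : HasDerivAt (fun t : ℝ => 1 + t) 1 t := (hasDerivAt_id t).const_add 1
    refine ((((hx.mul ((h.hasDerivAt t ht).const_mul r)).pow 2).add
      (((hx.mul (h.hasDerivAt_deriv t ht)).add (h.hasDerivAt t ht)).pow 2)).add
      (((h.hasDerivAt t ht).pow 2).const_mul (μ - 2))).congr_deriv ?_
    simp
    field_simp
    ring
  · have : 0 < 1 + t := by linarith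
    have : 0 ≤ 2 * (μ - 2) * (1 + t) * y' t ^ 2 :=
      mul_nonneg (mul_nonneg (by linarith) this.le) (sq_nonneg _)
    linarith

/-- Decay of order 1/(1+t), uniform in r. It is the input for times with r(1+t) ≤ 1, where the
Bessel energy gives no control. -/
lemma abs_le_of_data (h : IsWave μ r y y') (hμ : 2 ≤ μ) {δ : ℝ}
    (h1 : |y 0| ≤ δ) (h2 : |r * y 0| ≤ δ) (h3 : |y' 0| ≤ δ) {t : ℝ} (ht : 0 ≤ t) :
    |(1 + t) * (r * y t)| ≤ Real.sqrt (μ + 3) * δ ∧ |y t| ≤ Real.sqrt (μ + 3) * δ ∧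
      |(1 + t) * y' t| ≤ 2 * (Real.sqrt (μ + 3) * δ) := by
  have hδ : 0 ≤ δ := (abs_nonneg _).trans h1
  -- The initial weighted energy is at most δ² + (2δ)² + (μ-2)δ² = (μ+3)δ².
  set B := Real.sqrt (μ + 3) * δ with hB
  have hB2 : B ^ 2 = (μ + 3) * δ ^ 2 := by rw [hB, mul_pow, Real.sq_sqrt (by linarith)]
  have hBδ : δ ≤ B := le_mul_of_one_le_left hδ (Real.one_le_sqrt.2 (by linarith))
  have hB0 : 0 ≤ B := hδ.trans hBδ
  have hF : ∀ t, 0 ≤ t → ((1 + t) * (r * y t)) ^ 2 + ((1 + t) * y' t + y t) ^ 2 ≤ B ^ 2 := by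
    intro t ht
    have e0 := h.weighted_energy_le hμ ht
    have e1 : (r * y 0) ^ 2 ≤ δ ^ 2 := sq_le_sq' (abs_le.1 h2).1 (abs_le.1 h2).2
    have e2 : y 0 ^ 2 ≤ δ ^ 2 := sq_le_sq' (abs_le.1 h1).1 (abs_le.1 h1).2
    have e3 : |y' 0 + y 0| ≤ 2 * δ := (abs_add_le _ _).trans (by linarith)
    have e4 : (y' 0 + y 0) ^ 2 ≤ (2 * δ) ^ 2 := sq_le_sq' (abs_le.1 e3).1 (abs_le.1 e3).2
    have e5 : 0 ≤ (μ - 2) * y t ^ 2 := mul_nonneg (by linarith) (sq_nonneg _)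
    have e6 : (μ - 2) * y 0 ^ 2 ≤ (μ - 2) * δ ^ 2 := by
      apply mul_le_mul_of_nonneg_left e2; linarith
    rw [hB2]
    nlinarith
  have hd : ∀ t, 0 ≤ t → |(1 + t) * y' t + y t| ≤ B := fun t ht =>
    abs_le_of_sq_le_sq (by nlinarith [hF t ht, sq_nonneg ((1 + t) * (r * y t))]) hB0
  have hx : 0 < 1 + t := by linarith
  have hy : |y t| ≤ B := by
    -- The quantity bounded in `hd` is the derivative of (1+t) y, so y itself stays bounded even
    -- when μ = 2 and the weighted energy carries no y² term.
    have hdist := Convex.norm_image_sub_le_of_norm_hasDerivWithin_le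
      (f := fun t => (1 + t) * y t) (f' := fun t => (1 + t) * y' t + y t) (C := B)
      (s := Set.Ici 0) (x := 0) (y := t) (fun t ht => by
        refine (HasDerivAt.congr_deriv (((hasDerivAt_id t).const_add 1).mul
          (h.hasDerivAt t ht)) ?_).hasDerivWithinAt
        simp
        ring) (fun t ht => hd t ht) (convex_Ici 0) (Set.mem_Ici.2 le_rfl) ht
    simp only [add_zero, one_mul, sub_zero, Real.norm_eq_abs, abs_of_nonneg ht] at hdist
    have e1 : |(1 + t) * y t| ≤ (1 + t) * B := by
      calc |(1 + t) * y t| = |((1 + t) * y t - y 0) + y 0| := by ring_nf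
        _ ≤ B * t + δ := (abs_add_le _ _).trans (add_le_add hdist h1)
        _ ≤ _ := by linarith
    rw [abs_mul, abs_of_pos hx] at e1
    exact le_of_mul_le_mul_left e1 hx
  refine ⟨abs_le_of_sq_le_sq (by nlinarith [hF t ht, sq_nonneg ((1 + t) * y' t + y t)]) hB0,
    hy, ?_⟩
  calc |(1 + t) * y' t| = |((1 + t) * y' t + y t) - y t| := by ring_nf
    _ ≤ B + B := (abs_sub _ _).trans (add_le_add (hd t ht) hy)
    _ = 2 * B := by ring

end IsWave

/-! ### From Bessel solutions to waves: uniform decay and asymptotics -/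

/-- The solution of the dissipative wave equation at the frequency `r` that is obtained from a
solution of the Bessel equation. -/
def waveOfBessel (a : ℝ) (W : ℝ → ℝ) (r t : ℝ) : ℝ := (1 + t) ^ (-a) * W (r * (1 + t))

/-- The time derivative of `waveOfBessel`. -/
def waveOfBesselDeriv (a : ℝ) (W W' : ℝ → ℝ) (r t : ℝ) : ℝ :=
  (1 + t) ^ (-a) * (r * W' (r * (1 + t)) - a / (1 + t) * W (r * (1 + t)))

namespace IsBesselSolution

variable {a c : ℝ} {W W' : ℝ → ℝ}

lemma isWave (h : IsBesselSolution (a * (a - 1)) W W') {r : ℝ} (hr : 0 < r) :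
    IsWave (2 * a) r (waveOfBessel a W r) (waveOfBesselDeriv a W W' r) := by
  have hx : ∀ t : ℝ, HasDerivAt (fun t : ℝ => 1 + t) 1 t :=
    fun t => (hasDerivAt_id t).const_add 1
  have hp : ∀ t : ℝ, 0 ≤ t →
      HasDerivAt (fun t : ℝ => (1 + t) ^ (-a)) (-a * (1 + t) ^ (-a) / (1 + t)) t := by
    intro t ht
    have h0 : 0 < 1 + t := by linarith
    refine ((hx t).rpow_const (p := -a) (Or.inl h0.ne')).congr_deriv ?_
    rw [Real.rpow_sub_one h0.ne']
    ring
  have hs : ∀ t : ℝ, HasDerivAt (fun t : ℝ => r * (1 + t)) r t := fun t =>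
    ((hx t).const_mul r).congr_deriv (mul_one r)
  have hW : ∀ t : ℝ, 0 ≤ t →
      HasDerivAt (fun t => W (r * (1 + t))) (W' (r * (1 + t)) * r) t := fun t ht =>
    HasDerivAt.comp t (h.hasDerivAt _ (by positivity)) (hs t)
  have hW' : ∀ t : ℝ, 0 ≤ t → HasDerivAt (fun t => W' (r * (1 + t)))
      ((a * (a - 1) / (r * (1 + t)) ^ 2 - 1) * W (r * (1 + t)) * r) t := fun t ht =>
    HasDerivAt.comp t (h.hasDerivAt_deriv _ (by positivity)) (hs t)
  constructor
  · intro t ht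
    have h0 : 0 < 1 + t := by linarith
    refine ((hp t ht).mul (hW t ht)).congr_deriv ?_
    rw [waveOfBesselDeriv]
    field_simp
    ring
  · intro t ht
    have h0 : 0 < 1 + t := by linarith
    have hq : HasDerivAt (fun t : ℝ => a / (1 + t)) (-a / (1 + t) ^ 2) t := by
      refine ((hasDerivAt_const t a).div (hx t) h0.ne').congr_deriv ?_
      ring
    refine ((hp t ht).mul (((hW' t ht).const_mul r).sub (hq.mul (hW t ht)))).congr_deriv ?_
    simp only [waveOfBesselDeriv, waveOfBessel, Pi.sub_apply, Pi.mul_apply]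
    field_simp
    ring

lemma rpow_mul_wave (W : ℝ → ℝ) (a r : ℝ) {t : ℝ} (ht : 0 ≤ t) :
    (1 + t) ^ a * waveOfBessel a W r t = W (r * (1 + t)) := by
  rw [waveOfBessel, ← mul_assoc, ← Real.rpow_add (by linarith)]
  simp

lemma rpow_mul_waveDeriv (W W' : ℝ → ℝ) (a r : ℝ) {t : ℝ} (ht : 0 ≤ t) :
    (1 + t) ^ a * waveOfBesselDeriv a W W' r t =
      r * W' (r * (1 + t)) - a / (1 + t) * W (r * (1 + t)) := by
  rw [waveOfBesselDeriv, ← mul_assoc, ← Real.rpow_add (by linarith)]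
  simp

/-- The uniform decay of the energy. -/
theorem exists_uniform_bound (ha : 1 ≤ a) :
    ∃ C, ∀ (W W' : ℝ → ℝ) (r δ t : ℝ), IsBesselSolution (a * (a - 1)) W W' → 0 < r → δ ≤ 1 →
      δ ≤ r ^ (a - 1) → |waveOfBessel a W r 0| ≤ δ → |r * waveOfBessel a W r 0| ≤ δ →
      |waveOfBesselDeriv a W W' r 0| ≤ δ → 0 ≤ t →
      |(1 + t) ^ a * (r * waveOfBessel a W r t)| ≤ C ∧
        |(1 + t) ^ a * waveOfBesselDeriv a W W' r t| ≤ C := by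
  set B := Real.sqrt (2 * a + 3)
  have hB0 : 0 ≤ B := Real.sqrt_nonneg _
  have hc : 0 ≤ a * (a - 1) := mul_nonneg (by linarith) (by linarith)
  set D := Real.sqrt (Real.exp (a * (a - 1)) * (B ^ 2 + ((2 + a) * B) ^ 2))
  have hD0 : 0 ≤ D := Real.sqrt_nonneg _
  refine ⟨2 * B + (1 + a) * D, ?_⟩
  intro W W' r δ t hW hr hδ1 hδr h1 h2 h3 ht
  have hδ : 0 ≤ δ := (abs_nonneg _).trans h1
  have hy := hW.isWave hr
  -- The weighted energy yields one power of 1+t out of a; the missing a-1 powers are paid for by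
  -- the smallness δ of the data.
  have near : ∀ t : ℝ, 0 ≤ t → (1 + t) ^ (a - 1) * δ ≤ 1 →
      |(1 + t) ^ a * (r * waveOfBessel a W r t)| ≤ B ∧
        |(1 + t) ^ a * waveOfBesselDeriv a W W' r t| ≤ 2 * B ∧
        |a / (1 + t) * W (r * (1 + t))| ≤ a * B := by
    intro t ht hx
    have h0 : 0 < 1 + t := by linarith
    obtain ⟨e1, e2, e3⟩ := hy.abs_le_of_data (by linarith) h1 h2 h3 ht
    have hpow : (1 + t) ^ a = (1 + t) ^ (a - 1) * (1 + t) := by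
      rw [Real.rpow_sub_one h0.ne']; field_simp
    have hq : 0 ≤ (1 + t) ^ (a - 1) := by positivity
    have hkey : (1 + t) ^ (a - 1) * (B * δ) ≤ B := by
      calc (1 + t) ^ (a - 1) * (B * δ) = B * ((1 + t) ^ (a - 1) * δ) := by ring
        _ ≤ B * 1 := by gcongr
        _ = B := mul_one B
    refine ⟨?_, ?_, ?_⟩
    · rw [hpow, mul_assoc, abs_mul, abs_of_nonneg hq]
      exact (mul_le_mul_of_nonneg_left e1 hq).trans hkey
    · rw [hpow, mul_assoc, abs_mul, abs_of_nonneg hq]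
      refine (mul_le_mul_of_nonneg_left e3 hq).trans ?_
      change (1 + t) ^ (a - 1) * (2 * (B * δ)) ≤ 2 * B
      linarith
    · rw [← rpow_mul_wave W a r ht, hpow]
      have : a / (1 + t) * ((1 + t) ^ (a - 1) * (1 + t) * waveOfBessel a W r t) =
          a * ((1 + t) ^ (a - 1) * waveOfBessel a W r t) := by
        field_simp
      rw [this, abs_mul, abs_of_nonneg (by linarith : 0 ≤ a), abs_mul, abs_of_nonneg hq]
      gcongr
      exact (mul_le_mul_of_nonneg_left e2 hq).trans hkey
  have hκ : 0 ≤ a - 1 := by linarith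
  -- The region r(1+t) ≥ 1 is entered at time 0 when r ≥ 1, where δ ≤ 1 suffices, and at 1/r - 1
  -- when r ≤ 1. In the latter case (1+t)^(a-1) ≤ r^(-(a-1)) until then, and δ ≤ r^(a-1) absorbs it.
  obtain ⟨t₀, ht₀, ht₀s, hnear⟩ : ∃ t₀ : ℝ, 0 ≤ t₀ ∧ 1 ≤ r * (1 + t₀) ∧
      ∀ t, 0 ≤ t → t ≤ t₀ → (1 + t) ^ (a - 1) * δ ≤ 1 := by
    rcases le_total 1 r with h | h
    · refine ⟨0, le_rfl, by simpa using h, fun t h0 h1 => ?_⟩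
      have : t = 0 := le_antisymm h1 h0
      simpa [this] using hδ1
    · refine ⟨r⁻¹ - 1, by linarith [(one_le_inv₀ hr).2 h], ?_, fun t h0 h1 => ?_⟩
      · simp [hr.ne']
      · calc (1 + t) ^ (a - 1) * δ ≤ (r⁻¹) ^ (a - 1) * r ^ (a - 1) := by
              gcongr
              linarith
          _ = 1 := by
              rw [← Real.mul_rpow (by positivity) hr.le, inv_mul_cancel₀ hr.ne', Real.one_rpow]
  -- Up to t₀ the weighted energy is enough. After t₀ the Bessel energy propagates the bounds
  -- reached at t₀, at the cost of the factor exp(a(a-1)).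
  rcases le_total t t₀ with h | h
  · obtain ⟨e1, e2, -⟩ := near t ht (hnear t ht h)
    have : 0 ≤ (1 + a) * D := by positivity
    exact ⟨by linarith, by linarith⟩
  · obtain ⟨e1, e2, e3⟩ := near t₀ ht₀ (hnear t₀ ht₀ le_rfl)
    have hpos : 0 < 1 + t := by linarith
    have hs : r * (1 + t₀) ≤ r * (1 + t) := by gcongr
    have hs1 : 1 ≤ r * (1 + t) := ht₀s.trans hs
    have e := hW.sq_add_sq_le hc ht₀s hs
    have f1 : |r * W (r * (1 + t₀))| ≤ B := by
      rw [← rpow_mul_wave W a r ht₀]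
      refine le_trans (le_of_eq ?_) e1
      ring_nf
    have f2 : |r * W' (r * (1 + t₀))| ≤ (2 + a) * B := by
      have := rpow_mul_waveDeriv W W' a r ht₀
      rw [← sub_add_cancel (r * W' (r * (1 + t₀))) (a / (1 + t₀) * W (r * (1 + t₀))), ← this]
      exact (abs_add_le _ _).trans (by linarith)
    have f3 : (r * W (r * (1 + t))) ^ 2 + (r * W' (r * (1 + t))) ^ 2 ≤
        Real.exp (a * (a - 1)) * (B ^ 2 + ((2 + a) * B) ^ 2) := by
      have g1 := sq_le_sq' (abs_le.1 f1).1 (abs_le.1 f1).2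
      have g2 := sq_le_sq' (abs_le.1 f2).1 (abs_le.1 f2).2
      calc _ = r ^ 2 * (W (r * (1 + t)) ^ 2 + W' (r * (1 + t)) ^ 2) := by ring
        _ ≤ r ^ 2 * (Real.exp (a * (a - 1)) *
            (W (r * (1 + t₀)) ^ 2 + W' (r * (1 + t₀)) ^ 2)) := by gcongr
        _ = Real.exp (a * (a - 1)) *
            ((r * W (r * (1 + t₀))) ^ 2 + (r * W' (r * (1 + t₀))) ^ 2) := by ring
        _ ≤ _ := by gcongr
    have k1 : |r * W (r * (1 + t))| ≤ D :=
      Real.abs_le_sqrt (by nlinarith [sq_nonneg (r * W' (r * (1 + t)))])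
    have k2 : |r * W' (r * (1 + t))| ≤ D :=
      Real.abs_le_sqrt (by nlinarith [sq_nonneg (r * W (r * (1 + t)))])
    constructor
    · have : (1 + t) ^ a * (r * waveOfBessel a W r t) = r * W (r * (1 + t)) := by
        rw [← rpow_mul_wave W a r ht]; ring
      rw [this]
      nlinarith
    · rw [rpow_mul_waveDeriv W W' a r ht]
      have k3 : |a / (1 + t) * W (r * (1 + t))| ≤ a * D := by
        have : a / (1 + t) * W (r * (1 + t)) =
            a * ((r * (1 + t))⁻¹ * (r * W (r * (1 + t)))) := by field_simp
        rw [this, abs_mul, abs_mul, abs_of_nonneg (by linarith : 0 ≤ a),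
          abs_of_nonneg (by positivity : 0 ≤ (r * (1 + t))⁻¹)]
        gcongr
        exact (mul_le_of_le_one_left (abs_nonneg _) (inv_le_one_of_one_le₀ hs1)).trans k1
      refine (abs_sub _ _).trans ?_
      nlinarith

/-- The asymptotics of the solution in coordinates rotating with the free solutions. -/
lemma tendsto_wave (h : IsBesselSolution c W W') (hc : 0 ≤ c) (a : ℝ) {p q : ℝ}
    (hp : Tendsto (fun s => Real.cos s * W s - Real.sin s * W' s) atTop (𝓝 p))
    (hq : Tendsto (fun s => Real.sin s * W s + Real.cos s * W' s) atTop (𝓝 q))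
    {r : ℝ} (hr : 0 < r) :
    Tendsto (fun t => Real.cos (t * r) * ((1 + t) ^ a * (r * waveOfBessel a W r t)) -
      Real.sin (t * r) * ((1 + t) ^ a * waveOfBesselDeriv a W W' r t)) atTop
      (𝓝 (r * (Real.cos r * p + Real.sin r * q))) ∧
    Tendsto (fun t => Real.sin (t * r) * ((1 + t) ^ a * (r * waveOfBessel a W r t)) +
      Real.cos (t * r) * ((1 + t) ^ a * waveOfBesselDeriv a W W' r t)) atTop
      (𝓝 (r * (Real.cos r * q - Real.sin r * p))) := by
  obtain ⟨C, hC⟩ := h.exists_bound hc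
  have hx : Tendsto (fun t : ℝ => 1 + t) atTop atTop := tendsto_atTop_add_const_left _ _ tendsto_id
  have hs : Tendsto (fun t : ℝ => r * (1 + t)) atTop atTop := hx.const_mul_atTop hr
  have hsmall : Tendsto (fun t : ℝ => |a| * C * (1 + t)⁻¹) atTop (𝓝 0) := by
    simpa using (tendsto_inv_atTop_zero.comp hx).const_mul (|a| * C)
  have herr : ∀ g : ℝ → ℝ, (∀ t, |g t| ≤ 1) →
      Tendsto (fun t : ℝ => g (t * r) * (a / (1 + t) * W (r * (1 + t)))) atTop (𝓝 0) := by
    intro g hg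
    refine squeeze_zero_norm' ?_ hsmall
    filter_upwards [hs.eventually_ge_atTop 1, eventually_ge_atTop 0] with t ht ht0
    have : 0 < 1 + t := by linarith
    rw [Real.norm_eq_abs, abs_mul, abs_mul, abs_div, abs_of_pos this]
    calc |g (t * r)| * (|a| / (1 + t) * |W (r * (1 + t))|) ≤ 1 * (|a| / (1 + t) * C) := by
          gcongr
          · exact hg _
          · exact (hC _ ht).1
      _ = _ := by ring
  have hp' := hp.comp hs
  have hq' := hq.comp hs
  constructor
  · have := (((hp'.const_mul (Real.cos r)).add (hq'.const_mul (Real.sin r))).const_mul r).add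
      (herr Real.sin Real.abs_sin_le_one)
    rw [add_zero] at this
    refine this.congr' ?_
    filter_upwards [eventually_ge_atTop 0] with t ht
    have e1 : (1 + t) ^ a * (r * waveOfBessel a W r t) = r * W (r * (1 + t)) := by
      rw [← rpow_mul_wave W a r ht]; ring
    -- The free phase is t r while the Bessel phase is s = r(1+t); the difference r explains the
    -- rotation by r in the limit.
    have e2 : t * r = r * (1 + t) - r := by ring
    rw [e1, rpow_mul_waveDeriv W W' a r ht, e2, Real.cos_sub, Real.sin_sub]
    simp only [Function.comp]
    ring
  · have := (((hq'.const_mul (Real.cos r)).sub (hp'.const_mul (Real.sin r))).const_mul r).sub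
      (herr Real.cos Real.abs_cos_le_one)
    rw [sub_zero] at this
    refine this.congr' ?_
    filter_upwards [eventually_ge_atTop 0] with t ht
    have e1 : (1 + t) ^ a * (r * waveOfBessel a W r t) = r * W (r * (1 + t)) := by
      rw [← rpow_mul_wave W a r ht]; ring
    have e2 : t * r = r * (1 + t) - r := by ring
    rw [e1, rpow_mul_waveDeriv W W' a r ht, e2, Real.cos_sub, Real.sin_sub]
    simp only [Function.comp]
    ring

end IsBesselSolution

/-! ### Radial symbols relating f to the Cauchy data -/

/-- The symbol `[ξ]` as a function of `|ξ|`. -/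
def radialBracket (r : ℝ) : ℝ := r / Real.sqrt (1 + r ^ 2)

/-- The radial symbols that map `f = [D]^{-κ} (⟨D⟩ u₁, u₂)` to the data `(u₁, u₂)`. -/
def dataWeight (κ : ℝ) : Fin 2 → ℝ → ℝ :=
  ![fun r => radialBracket r ^ κ / Real.sqrt (1 + r ^ 2), fun r => radialBracket r ^ κ]

lemma sqrt_one_add_sq_pos (r : ℝ) : 0 < Real.sqrt (1 + r ^ 2) := Real.sqrt_pos.2 (by positivity)

lemma one_le_sqrt_one_add_sq (r : ℝ) : 1 ≤ Real.sqrt (1 + r ^ 2) :=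
  Real.one_le_sqrt.2 (by nlinarith [sq_nonneg r])

lemma le_sqrt_one_add_sq (r : ℝ) : r ≤ Real.sqrt (1 + r ^ 2) :=
  Real.le_sqrt_of_sq_le (by linarith)

lemma radialBracket_nonneg {r : ℝ} (hr : 0 ≤ r) : 0 ≤ radialBracket r :=
  div_nonneg hr (Real.sqrt_nonneg _)

lemma radialBracket_pos {r : ℝ} (hr : 0 < r) : 0 < radialBracket r :=
  div_pos hr (sqrt_one_add_sq_pos r)

lemma radialBracket_le_one (r : ℝ) : radialBracket r ≤ 1 :=
  div_le_one_of_le₀ (le_sqrt_one_add_sq r) (Real.sqrt_nonneg _)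

lemma radialBracket_le {r : ℝ} (hr : 0 ≤ r) : radialBracket r ≤ r :=
  div_le_self hr (one_le_sqrt_one_add_sq r)

lemma continuous_sqrt_one_add_sq : Continuous fun r : ℝ => Real.sqrt (1 + r ^ 2) := by fun_prop

lemma continuous_radialBracket : Continuous radialBracket :=
  continuous_id.div continuous_sqrt_one_add_sq fun r => (sqrt_one_add_sq_pos r).ne'

lemma continuousOn_dataWeight (κ : ℝ) (j : Fin 2) : ContinuousOn (dataWeight κ j) (Set.Ioi 0) := by
  have h : ContinuousOn (fun r => radialBracket r ^ κ) (Set.Ioi 0) :=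
    continuous_radialBracket.continuousOn.rpow_const
      fun r hr => Or.inl (radialBracket_pos hr).ne'
  fin_cases j
  · exact h.div continuous_sqrt_one_add_sq.continuousOn fun r _ => (sqrt_one_add_sq_pos r).ne'
  · exact h

lemma measurable_dataWeight (κ : ℝ) (j : Fin 2) : Measurable (dataWeight κ j) := by
  have h : Measurable fun r => radialBracket r ^ κ :=
    continuous_radialBracket.measurable.pow_const κ
  fin_cases j
  · exact h.div continuous_sqrt_one_add_sq.measurable
  · exact h

lemma dataWeight_nonneg (κ : ℝ) (j : Fin 2) {r : ℝ} (hr : 0 ≤ r) : 0 ≤ dataWeight κ j r := by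
  have h : 0 ≤ radialBracket r ^ κ := Real.rpow_nonneg (radialBracket_nonneg hr) κ
  fin_cases j
  · exact div_nonneg h (Real.sqrt_nonneg _)
  · exact h

lemma tendsto_sqrt_one_add_sq : Tendsto (fun r : ℝ => Real.sqrt (1 + r ^ 2)) atTop atTop :=
  tendsto_atTop_mono le_sqrt_one_add_sq tendsto_id

lemma tendsto_radialBracket : Tendsto radialBracket atTop (𝓝 1) := by
  have h : Tendsto (fun r => 1 - (Real.sqrt (1 + r ^ 2))⁻¹) atTop (𝓝 1) := by
    simpa using (tendsto_inv_atTop_zero.comp tendsto_sqrt_one_add_sq).const_sub 1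
  refine tendsto_of_tendsto_of_tendsto_of_le_of_le' h tendsto_const_nhds ?_
    (Eventually.of_forall radialBracket_le_one)
  filter_upwards [eventually_ge_atTop 0] with r hr
  have h0 := sqrt_one_add_sq_pos r
  rw [radialBracket, inv_eq_one_div, one_sub_div h0.ne']
  gcongr
  have : Real.sqrt (1 + r ^ 2) ≤ 1 + r := by
    rw [Real.sqrt_le_left (by linarith)]
    nlinarith
  linarith

lemma tendsto_radialBracket_rpow (κ : ℝ) :
    Tendsto (fun r => radialBracket r ^ κ) atTop (𝓝 1) := by
  simpa using tendsto_radialBracket.rpow_const (p := κ) (Or.inl one_ne_zero)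

/-! ### Scattering at one frequency -/

/-- A pair of solutions of the Bessel equation with Wronskian `1`, with the limits `(p i, q i)` of
the solutions in coordinates rotating with the free solutions. -/
structure IsBesselPair (c : ℝ) (W W' : Fin 2 → ℝ → ℝ) (p q : Fin 2 → ℝ) : Prop where
  solution : ∀ i, IsBesselSolution c (W i) (W' i)
  wronskian : ∀ s, 0 < s → W 0 s * W' 1 s - W 1 s * W' 0 s = 1
  tendsto_fst : ∀ i,
    Tendsto (fun s => Real.cos s * W i s - Real.sin s * W' i s) atTop (𝓝 (p i))
  tendsto_snd : ∀ i,
    Tendsto (fun s => Real.sin s * W i s + Real.cos s * W' i s) atTop (𝓝 (q i))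

theorem exists_isBesselPair {c : ℝ} (hc : 0 ≤ c) : ∃ W W' p q, IsBesselPair c W W' p q := by
  obtain ⟨W₀, W₀', h0, h00, h01⟩ := exists_isBesselSolution c 1 0
  obtain ⟨W₁, W₁', h1, h10, h11⟩ := exists_isBesselSolution c 0 1
  obtain ⟨p₀, q₀, hp0, hq0⟩ := h0.exists_tendsto_rotated hc
  obtain ⟨p₁, q₁, hp1, hq1⟩ := h1.exists_tendsto_rotated hc
  refine ⟨![W₀, W₁], ![W₀', W₁'], ![p₀, p₁], ![q₀, q₁], ?_, ?_, ?_, ?_⟩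
  · intro i; fin_cases i
    exacts [h0, h1]
  · intro s hs
    have := h0.wronskian_eq h1 hs
    simpa [h00, h01, h10, h11] using this
  · intro i; fin_cases i
    exacts [hp0, hp1]
  · intro i; fin_cases i
    exacts [hq0, hq1]

/-- The symbol, as a function of `|ξ|`, that maps `(|ξ| w, w')` at `t = 0` to its limit in
coordinates rotating with the free waves, where `w = (1 + t)^{μ/2} u`. -/
def scatteringSymbol (W W' : Fin 2 → ℝ → ℝ) (p q : Fin 2 → ℝ) (r : ℝ) :
    Matrix (Fin 2) (Fin 2) ℝ :=
  !![Real.cos r * (W' 1 r * p 0 - W' 0 r * p 1) + Real.sin r * (W' 1 r * q 0 - W' 0 r * q 1),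
     Real.cos r * (W 0 r * p 1 - W 1 r * p 0) + Real.sin r * (W 0 r * q 1 - W 1 r * q 0);
     Real.cos r * (W' 1 r * q 0 - W' 0 r * q 1) - Real.sin r * (W' 1 r * p 0 - W' 0 r * p 1),
     Real.cos r * (W 0 r * q 1 - W 1 r * q 0) - Real.sin r * (W 0 r * p 1 - W 1 r * p 0)]

namespace IsBesselPair

variable {c : ℝ} {W W' : Fin 2 → ℝ → ℝ} {p q : Fin 2 → ℝ}

/-- A rotation has determinant one, so the Wronskian is the same in rotating coordinates and passes
to the limit. -/
lemma wronskian_limit (h : IsBesselPair c W W' p q) : p 0 * q 1 - p 1 * q 0 = 1 := by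
  refine tendsto_nhds_unique (((h.tendsto_fst 0).mul (h.tendsto_snd 1)).sub
    ((h.tendsto_fst 1).mul (h.tendsto_snd 0))) (tendsto_const_nhds.congr' ?_)
  filter_upwards [eventually_gt_atTop 0] with s hs
  linear_combination (-(Real.cos s ^ 2 + Real.sin s ^ 2)) * h.wronskian s hs -
    Real.cos_sq_add_sin_sq s

lemma continuousOn_scatteringSymbol (h : IsBesselPair c W W' p q) (i j : Fin 2) :
    ContinuousOn (fun r => scatteringSymbol W W' p q r i j) (Set.Ioi 0) := by
  have h0 := (h.solution 0).continuousOn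
  have h1 := (h.solution 1).continuousOn
  have h0' := (h.solution 0).continuousOn_deriv
  have h1' := (h.solution 1).continuousOn_deriv
  fin_cases i <;> fin_cases j <;> simp [scatteringSymbol] <;> fun_prop

/-- The deviation of the scattering symbol from the identity, in rotating coordinates. -/
lemma abs_scatteringSymbol_sub_one_le (r : ℝ) (i j : Fin 2) :
    let P := fun i => Real.cos r * W i r - Real.sin r * W' i r
    let Q := fun i => Real.sin r * W i r + Real.cos r * W' i r
    |scatteringSymbol W W' p q r i j - (1 : Matrix (Fin 2) (Fin 2) ℝ) i j| ≤
      |P 1 * p 0 - P 0 * p 1| + |Q 1 * p 0 - Q 0 * p 1 - 1| +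
        |P 0 * q 1 - P 1 * q 0 - 1| + |Q 0 * q 1 - Q 1 * q 0| := by
  intro P Q
  have hcs := Real.cos_sq_add_sin_sq r
  -- Undoing the rotation writes the deviation as a combination of four errors, each vanishing in
  -- the limit, with coefficients that are products of two sines or cosines.
  have hW : ∀ i, W i r = Real.cos r * P i + Real.sin r * Q i := fun i => by
    simp only [P, Q]; linear_combination (-(W i r)) * hcs
  have hW' : ∀ i, W' i r = Real.cos r * Q i - Real.sin r * P i := fun i => by
    simp only [P, Q]; linear_combination (-(W' i r)) * hcs
  clear_value P Q
  have bound : ∀ x₁ x₂ x₃ x₄ e₁ e₂ e₃ e₄ : ℝ, |x₁| ≤ 1 → |x₂| ≤ 1 → |x₃| ≤ 1 → |x₄| ≤ 1 →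
      |x₁ * e₁ + x₂ * e₂ + x₃ * e₃ + x₄ * e₄| ≤ |e₁| + |e₂| + |e₃| + |e₄| := by
    intro x₁ x₂ x₃ x₄ e₁ e₂ e₃ e₄ h1 h2 h3 h4
    have f : ∀ x e : ℝ, |x| ≤ 1 → |x * e| ≤ |e| := fun x e h => by
      rw [abs_mul]; exact mul_le_of_le_one_left (abs_nonneg e) h
    exact (abs_add_le _ _).trans (add_le_add ((abs_add_le _ _).trans
      (add_le_add ((abs_add_le _ _).trans (add_le_add (f _ _ h1) (f _ _ h2))) (f _ _ h3)))
      (f _ _ h4))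
  have hcc : |Real.cos r * Real.cos r| ≤ 1 := by
    rw [abs_mul]; exact mul_le_one₀ (Real.abs_cos_le_one r) (abs_nonneg _) (Real.abs_cos_le_one r)
  have hss : |Real.sin r * Real.sin r| ≤ 1 := by
    rw [abs_mul]; exact mul_le_one₀ (Real.abs_sin_le_one r) (abs_nonneg _) (Real.abs_sin_le_one r)
  have hsc : |Real.sin r * Real.cos r| ≤ 1 := by
    rw [abs_mul]; exact mul_le_one₀ (Real.abs_sin_le_one r) (abs_nonneg _) (Real.abs_cos_le_one r)
  have hsc' : |-(Real.sin r * Real.cos r)| ≤ 1 := by rwa [abs_neg]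
  have hcc' : |-(Real.cos r * Real.cos r)| ≤ 1 := by rwa [abs_neg]
  fin_cases i <;> fin_cases j
  · refine le_trans (le_of_eq ?_) (bound (-(Real.sin r * Real.cos r)) (Real.cos r * Real.cos r)
      (Real.sin r * Real.sin r) (-(Real.sin r * Real.cos r)) _ _ _ _ hsc' hcc hss hsc')
    congr 1
    simp [scatteringSymbol, hW, hW']
    linear_combination hcs
  · refine le_trans (le_of_eq ?_) (bound (-(Real.cos r * Real.cos r)) (-(Real.sin r * Real.cos r))
      (Real.sin r * Real.cos r) (Real.sin r * Real.sin r) _ _ _ _ hcc' hsc' hsc hss)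
    congr 1
    simp [scatteringSymbol, hW, hW']
    ring
  · refine le_trans (le_of_eq ?_) (bound (Real.sin r * Real.sin r) (-(Real.sin r * Real.cos r))
      (Real.sin r * Real.cos r) (-(Real.cos r * Real.cos r)) _ _ _ _ hss hsc' hsc hcc')
    congr 1
    simp [scatteringSymbol, hW, hW']
    ring
  · refine le_trans (le_of_eq ?_) (bound (Real.sin r * Real.cos r) (Real.sin r * Real.sin r)
      (Real.cos r * Real.cos r) (Real.sin r * Real.cos r) _ _ _ _ hsc hss hcc hsc)
    congr 1
    simp [scatteringSymbol, hW, hW']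
    linear_combination hcs

/-- As r → ∞ the rotated data at s = r approach their own limits (p, q). The four errors then become
trivial identities or the relation p₀q₁ - p₁q₀ = 1. -/
lemma tendsto_scatteringSymbol (h : IsBesselPair c W W' p q) (i j : Fin 2) :
    Tendsto (fun r => scatteringSymbol W W' p q r i j) atTop
      (𝓝 ((1 : Matrix (Fin 2) (Fin 2) ℝ) i j)) := by
  rw [tendsto_iff_norm_sub_tendsto_zero]
  have hw := h.wronskian_limit
  have e1 := (((h.tendsto_fst 1).mul_const (p 0)).sub ((h.tendsto_fst 0).mul_const (p 1))).abs
  have e2 := ((((h.tendsto_snd 1).mul_const (p 0)).sub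
    ((h.tendsto_snd 0).mul_const (p 1))).sub_const 1).abs
  have e3 := ((((h.tendsto_fst 0).mul_const (q 1)).sub
    ((h.tendsto_fst 1).mul_const (q 0))).sub_const 1).abs
  have e4 := (((h.tendsto_snd 0).mul_const (q 1)).sub ((h.tendsto_snd 1).mul_const (q 0))).abs
  have hsum := ((e1.add e2).add e3).add e4
  have hz : |p 1 * p 0 - p 0 * p 1| + |q 1 * p 0 - q 0 * p 1 - 1| + |p 0 * q 1 - p 1 * q 0 - 1| +
      |q 0 * q 1 - q 1 * q 0| = 0 := by
    have z1 : p 1 * p 0 - p 0 * p 1 = 0 := by ring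
    have z2 : q 1 * p 0 - q 0 * p 1 - 1 = 0 := by linarith
    have z3 : p 0 * q 1 - p 1 * q 0 - 1 = 0 := by linarith
    have z4 : q 0 * q 1 - q 1 * q 0 = 0 := by ring
    simp [z1, z2, z3, z4]
  rw [hz] at hsum
  exact squeeze_zero (fun _ => norm_nonneg _)
    (fun r => abs_scatteringSymbol_sub_one_le r i j) hsum

/-- Without the potential `c / s²`, the rotating coordinates are constant. -/
lemma rotated_eq (h : IsBesselPair 0 W W' p q) (i : Fin 2) {r : ℝ} (hr : 0 < r) :
    Real.cos r * W i r - Real.sin r * W' i r = p i ∧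
      Real.sin r * W i r + Real.cos r * W' i r = q i := by
  have hd : ∀ s ∈ Set.Ioi (0 : ℝ), _ := fun s hs => (h.solution i).hasDerivAt_rotated hs
  have hconst : ∀ F : ℝ → ℝ, (∀ s ∈ Set.Ioi (0 : ℝ), HasDerivAt F 0 s) →
      ∀ s ∈ Set.Ioi (0 : ℝ), F s = F r := fun F hF s hs =>
    isOpen_Ioi.is_const_of_deriv_eq_zero isPreconnected_Ioi
      (fun s hs => (hF s hs).differentiableAt.differentiableWithinAt)
      (fun s hs => (hF s hs).deriv) hs hr
  constructor
  · refine tendsto_nhds_unique (tendsto_const_nhds.congr' ?_) (h.tendsto_fst i)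
    filter_upwards [eventually_gt_atTop 0] with s hs
    exact (hconst _ (fun s hs => (hd s hs).1.congr_deriv (by simp)) s hs).symm
  · refine tendsto_nhds_unique (tendsto_const_nhds.congr' ?_) (h.tendsto_snd i)
    filter_upwards [eventually_gt_atTop 0] with s hs
    exact (hconst _ (fun s hs => (hd s hs).2.congr_deriv (by simp)) s hs).symm

/-- For c = 0 the rotated data already equal their limits at every r > 0, so all four errors are
zero. -/
lemma scatteringSymbol_eq_one (h : IsBesselPair 0 W W' p q) {r : ℝ} (hr : 0 < r) :
    scatteringSymbol W W' p q r = 1 := by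
  have hw := h.wronskian_limit
  ext i j
  have := abs_scatteringSymbol_sub_one_le (W := W) (W' := W') (p := p) (q := q) r i j
  simp only [(h.rotated_eq _ hr).1, (h.rotated_eq _ hr).2] at this
  have z1 : p 1 * p 0 - p 0 * p 1 = 0 := by ring
  have z2 : q 1 * p 0 - q 0 * p 1 - 1 = 0 := by linarith
  have z3 : p 0 * q 1 - p 1 * q 0 - 1 = 0 := by linarith
  have z4 : q 0 * q 1 - q 1 * q 0 = 0 := by ring
  rw [z1, z2, z3, z4] at this
  simp only [abs_zero, add_zero, abs_nonpos_iff, sub_eq_zero] at this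
  exact this

end IsBesselPair

/-! ### The fundamental system and the limit symbol -/

/-- The functions `Y 0 r` and `Y 1 r` are the solutions of the dissipative wave equation at the
frequency `r` with the data `(1, 0)` and `(0, 1)`. -/
structure IsFundamental (μ : ℝ) (Y Y' : Fin 2 → ℝ → ℝ → ℝ) : Prop where
  measurable : ∀ j t, Measurable fun r => Y j r t
  measurable_deriv : ∀ j t, Measurable fun r => Y' j r t
  isWave : ∀ j r, 0 < r → IsWave μ r (Y j r) (Y' j r)
  initial_value : ∀ j r, 0 < r → Y j r 0 = ![1, 0] j
  initial_deriv : ∀ j r, 0 < r → Y' j r 0 = ![0, 1] j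

/-- The matrix `K |ξ|` is the symbol of the limit of the energy operators in coordinates rotating
with the free waves. -/
structure IsLimitSymbol (μ : ℝ) (Y Y' : Fin 2 → ℝ → ℝ → ℝ) (K : ℝ → Matrix (Fin 2) (Fin 2) ℝ) :
    Prop where
  bound : ∃ C, ∀ j r t, 0 < r → 0 ≤ t →
    |(1 + t) ^ (μ / 2) * (r * Y j r t) * dataWeight ((μ - 2) / 2) j r| ≤ C ∧
      |(1 + t) ^ (μ / 2) * Y' j r t * dataWeight ((μ - 2) / 2) j r| ≤ C
  tendsto_fst : ∀ j r, 0 < r → Tendsto (fun t =>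
    Real.cos (t * r) * ((1 + t) ^ (μ / 2) * (r * Y j r t) * dataWeight ((μ - 2) / 2) j r) -
      Real.sin (t * r) * ((1 + t) ^ (μ / 2) * Y' j r t * dataWeight ((μ - 2) / 2) j r))
    atTop (𝓝 (K r 0 j))
  tendsto_snd : ∀ j r, 0 < r → Tendsto (fun t =>
    Real.sin (t * r) * ((1 + t) ^ (μ / 2) * (r * Y j r t) * dataWeight ((μ - 2) / 2) j r) +
      Real.cos (t * r) * ((1 + t) ^ (μ / 2) * Y' j r t * dataWeight ((μ - 2) / 2) j r))
    atTop (𝓝 (K r 1 j))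
  continuousOn : ∀ i j, ContinuousOn (fun r => K r i j) (Set.Ioi 0)
  tendsto_one : ∀ i j, Tendsto (fun r => K r i j) atTop (𝓝 ((1 : Matrix (Fin 2) (Fin 2) ℝ) i j))
  eq_of_two : μ = 2 → ∀ r, 0 < r → K r = !![radialBracket r, 0; (Real.sqrt (1 + r ^ 2))⁻¹, 1]

/-- Coefficients of the Bessel solution with Cauchy data `(b₁ / r, b₂ / r)` at `r`. -/
def cauchyCoeff (W W' : Fin 2 → ℝ → ℝ) (r b₁ b₂ : ℝ) : Fin 2 → ℝ :=
  ![(b₁ * W' 1 r - b₂ * W 1 r) / r, (b₂ * W 0 r - b₁ * W' 0 r) / r]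

lemma waveOfBessel_mul (a d : ℝ) (W : ℝ → ℝ) (r t : ℝ) :
    waveOfBessel a (fun s => d * W s) r t = d * waveOfBessel a W r t := by
  simp only [waveOfBessel]; ring

lemma waveOfBesselDeriv_mul (a d : ℝ) (W W' : ℝ → ℝ) (r t : ℝ) :
    waveOfBesselDeriv a (fun s => d * W s) (fun s => d * W' s) r t =
      d * waveOfBesselDeriv a W W' r t := by
  simp only [waveOfBesselDeriv]; ring

theorem exists_isFundamental {μ : ℝ} (hμ : 2 ≤ μ) :
    ∃ Y Y' K, IsFundamental μ Y Y' ∧ IsLimitSymbol μ Y Y' K := by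
  obtain ⟨a, rfl⟩ : ∃ a, μ = 2 * a := ⟨μ / 2, by ring⟩
  have ha : 1 ≤ a := by linarith
  have hκ : (2 * a - 2) / 2 = a - 1 := by ring
  have ha2 : 2 * a / 2 = a := by ring
  have hc : 0 ≤ a * (a - 1) := mul_nonneg (by linarith) (by linarith)
  obtain ⟨W, W', p, q, hP⟩ := exists_isBesselPair hc
  -- These are (r w, w') at t = 0 for w = (1+t)^a y, that is (r y(0), y'(0) + a y(0)), with data (1,
  -- 0) and (0, 1). The entry a in `b₂` comes from differentiating (1+t)^a.
  set b₁ : Fin 2 → ℝ → ℝ := fun j r => ![r, 0] j with hb₁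
  set b₂ : Fin 2 → ℝ := ![a, 1] with hb₂
  set α : Fin 2 → ℝ → Fin 2 → ℝ := fun j r => cauchyCoeff W W' r (b₁ j r) (b₂ j) with hα
  set w : Fin 2 → ℝ → ℝ → ℝ := fun j r s => α j r 0 * W 0 s + α j r 1 * W 1 s with hw
  set w' : Fin 2 → ℝ → ℝ → ℝ := fun j r s => α j r 0 * W' 0 s + α j r 1 * W' 1 s with hw'
  have hsol : ∀ j r, IsBesselSolution (a * (a - 1)) (w j r) (w' j r) := fun j r =>
    (hP.solution 0).lincomb (hP.solution 1) _ _
  have hwr : ∀ j r, 0 < r → w j r r = b₁ j r / r := by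
    intro j r hr
    simp only [hw, hα, cauchyCoeff, Matrix.cons_val_zero, Matrix.cons_val_one]
    field_simp
    linear_combination (b₁ j r) * hP.wronskian r hr
  have hwr' : ∀ j r, 0 < r → w' j r r = b₂ j / r := by
    intro j r hr
    simp only [hw', hα, cauchyCoeff, Matrix.cons_val_zero, Matrix.cons_val_one]
    field_simp
    linear_combination (b₂ j) * hP.wronskian r hr
  have hmW : ∀ i, Measurable (W i) := fun i => (hP.solution i).measurable
  have hmW' : ∀ i, Measurable (W' i) := fun i => (hP.solution i).measurable_deriv
  have hmb : ∀ j, Measurable (b₁ j) := by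
    intro j
    fin_cases j
    exacts [measurable_id, measurable_const]
  have hmα : ∀ j i, Measurable fun r => α j r i := by
    intro j i
    fin_cases i
    · exact ((((hmb j).mul (hmW' 1)).sub ((hmW 1).const_mul _)).div measurable_id)
    · exact ((((hmW 0).const_mul _).sub ((hmb j).mul (hmW' 0))).div measurable_id)
  have hy0 : ∀ j r, 0 < r → waveOfBessel a (w j r) r 0 = ![1, 0] j := by
    intro j r hr
    have : waveOfBessel a (w j r) r 0 = b₁ j r / r := by simp [waveOfBessel, hwr j r hr]
    rw [this]
    fin_cases j <;> simp [hb₁, hr.ne']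
  have hy0' : ∀ j r, 0 < r → waveOfBesselDeriv a (w j r) (w' j r) r 0 = ![0, 1] j := by
    intro j r hr
    have : waveOfBesselDeriv a (w j r) (w' j r) r 0 = b₂ j - a * (b₁ j r / r) := by
      simp [waveOfBesselDeriv, hwr j r hr, hwr' j r hr]
      field_simp
    rw [this]
    fin_cases j <;> simp [hb₁, hb₂, hr.ne']
  have hp : ∀ j r, Tendsto (fun s => Real.cos s * w j r s - Real.sin s * w' j r s) atTop
      (𝓝 (α j r 0 * p 0 + α j r 1 * p 1)) :=
    fun j r => (((hP.tendsto_fst 0).const_mul (α j r 0)).add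
      ((hP.tendsto_fst 1).const_mul (α j r 1))).congr fun s => by simp only [hw, hw']; ring
  have hq : ∀ j r, Tendsto (fun s => Real.sin s * w j r s + Real.cos s * w' j r s) atTop
      (𝓝 (α j r 0 * q 0 + α j r 1 * q 1)) :=
    fun j r => (((hP.tendsto_snd 0).const_mul (α j r 0)).add
      ((hP.tendsto_snd 1).const_mul (α j r 1))).congr fun s => by simp only [hw, hw']; ring
  refine ⟨fun j r => waveOfBessel a (w j r) r, fun j r => waveOfBesselDeriv a (w j r) (w' j r) r,
    fun r => Matrix.of fun i j => (scatteringSymbol W W' p q r i 0 * b₁ j r +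
      scatteringSymbol W W' p q r i 1 * b₂ j) * dataWeight (a - 1) j r,
    ⟨?_, ?_, ?_, hy0, hy0'⟩, ⟨?_, ?_, ?_, ?_, ?_, ?_⟩⟩
  · intro j t
    have hs : Measurable fun r : ℝ => r * (1 + t) := measurable_id.mul_const _
    exact (((hmα j 0).mul ((hmW 0).comp hs)).add ((hmα j 1).mul ((hmW 1).comp hs))).const_mul _
  · intro j t
    have hs : Measurable fun r : ℝ => r * (1 + t) := measurable_id.mul_const _
    exact (((measurable_id.mul
      (((hmα j 0).mul ((hmW' 0).comp hs)).add ((hmα j 1).mul ((hmW' 1).comp hs)))).sub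
      ((((hmα j 0).mul ((hmW 0).comp hs)).add
        ((hmα j 1).mul ((hmW 1).comp hs))).const_mul _))).const_mul _
  · exact fun j r hr => (hsol j r).isWave hr
  · obtain ⟨C, hC⟩ := IsBesselSolution.exists_uniform_bound ha
    refine ⟨C, fun j r t hr ht => ?_⟩
    rw [hκ, ha2]
    -- The uniform bound is applied to the solution multiplied by its weight d. Its data are then of
    -- size δ = [r]^(a-1), and [r] ≤ 1 and [r] ≤ r give the two conditions on δ.
    set d := dataWeight (a - 1) j r with hd
    have hd0 : 0 ≤ d := dataWeight_nonneg _ j hr.le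
    set δ := radialBracket r ^ (a - 1) with hδ
    have hδ0 : 0 ≤ δ := Real.rpow_nonneg (radialBracket_nonneg hr.le) _
    have hsol' : IsBesselSolution (a * (a - 1)) (fun s => d * w j r s) (fun s => d * w' j r s) := by
      have := (hsol j r).lincomb (hsol j r) d 0
      simpa only [zero_mul, add_zero] using this
    have h := hC _ _ r δ t hsol' hr
      (Real.rpow_le_one (radialBracket_nonneg hr.le) (radialBracket_le_one r) (by linarith))
      (Real.rpow_le_rpow (radialBracket_nonneg hr.le) (radialBracket_le hr.le) (by linarith))
    simp only [waveOfBessel_mul, waveOfBesselDeriv_mul, hy0 j r hr, hy0' j r hr] at h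
    have hdδ : |d| ≤ δ := by
      rw [abs_of_nonneg hd0, hd]
      fin_cases j
      · exact div_le_self hδ0 (one_le_sqrt_one_add_sq r)
      · exact le_rfl
    have h1 : |d * (![1, 0] : Fin 2 → ℝ) j| ≤ δ := by
      fin_cases j
      · simpa using hdδ
      · simpa using hδ0
    have h2 : |r * (d * (![1, 0] : Fin 2 → ℝ) j)| ≤ δ := by
      fin_cases j
      · have : r * d = δ * (r / Real.sqrt (1 + r ^ 2)) := by
          rw [hd, hδ]; simp only [dataWeight]; simp; ring
        simp only [Fin.zero_eta, Matrix.cons_val_zero, mul_one]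
        rw [abs_of_nonneg (mul_nonneg hr.le hd0)]
        exact this.le.trans (mul_le_of_le_one_right hδ0 (radialBracket_le_one r))
      · simpa using hδ0
    have h3 : |d * (![0, 1] : Fin 2 → ℝ) j| ≤ δ := by
      fin_cases j
      · simpa using hδ0
      · simpa using hdδ
    obtain ⟨e1, e2⟩ := h h1 h2 h3 ht
    constructor
    · refine le_trans (le_of_eq ?_) e1
      congr 1; ring
    · refine le_trans (le_of_eq ?_) e2
      congr 1; ring
  · intro j r hr
    rw [hκ, ha2]
    have h := ((hsol j r).tendsto_wave hc a (hp j r) (hq j r) hr).1.mul_const (dataWeight (a - 1) j r)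
    have hlim : r * (Real.cos r * (α j r 0 * p 0 + α j r 1 * p 1) +
        Real.sin r * (α j r 0 * q 0 + α j r 1 * q 1)) =
        scatteringSymbol W W' p q r 0 0 * b₁ j r + scatteringSymbol W W' p q r 0 1 * b₂ j := by
      simp [hα, cauchyCoeff, scatteringSymbol]
      field_simp
      ring
    rw [hlim] at h
    exact h.congr fun t => by ring
  · intro j r hr
    rw [hκ, ha2]
    have h := ((hsol j r).tendsto_wave hc a (hp j r) (hq j r) hr).2.mul_const (dataWeight (a - 1) j r)
    have hlim : r * (Real.cos r * (α j r 0 * q 0 + α j r 1 * q 1) -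
        Real.sin r * (α j r 0 * p 0 + α j r 1 * p 1)) =
        scatteringSymbol W W' p q r 1 0 * b₁ j r + scatteringSymbol W W' p q r 1 1 * b₂ j := by
      simp [hα, cauchyCoeff, scatteringSymbol]
      field_simp
      ring
    rw [hlim] at h
    exact h.congr fun t => by ring
  · intro i j
    have hb : ContinuousOn (b₁ j) (Set.Ioi 0) := by
      fin_cases j
      exacts [continuousOn_id, continuousOn_const]
    exact (((hP.continuousOn_scatteringSymbol i 0).mul hb).add
      ((hP.continuousOn_scatteringSymbol i 1).mul continuousOn_const)).mul
        (continuousOn_dataWeight _ j)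
  · intro i j
    have h0 := hP.tendsto_scatteringSymbol i 0
    have h1 := hP.tendsto_scatteringSymbol i 1
    -- The first weight behaves like 1/r: it normalizes the entry r of `b₁` to 1 and suppresses the
    -- entry a of `b₂`.
    have hd1 : Tendsto (dataWeight (a - 1) 1) atTop (𝓝 1) := tendsto_radialBracket_rpow _
    have hd0 : Tendsto (dataWeight (a - 1) 0) atTop (𝓝 0) := by
      have := (tendsto_radialBracket_rpow (a - 1)).mul
        (tendsto_inv_atTop_zero.comp tendsto_sqrt_one_add_sq)
      rw [mul_zero] at this
      exact this
    have hrd0 : Tendsto (fun r => r * dataWeight (a - 1) 0 r) atTop (𝓝 1) := by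
      have := (tendsto_radialBracket_rpow (a - 1)).mul tendsto_radialBracket
      rw [mul_one] at this
      refine this.congr fun r => ?_
      simp only [dataWeight, Matrix.cons_val_zero, radialBracket]
      ring
    fin_cases j
    · have := (h0.mul hrd0).add ((h1.const_mul a).mul hd0)
      rw [mul_one, mul_zero, add_zero] at this
      refine this.congr fun r => ?_
      simp [hb₁, hb₂]
      ring
    · have := h1.mul hd1
      rw [mul_one] at this
      refine this.congr fun r => ?_
      simp [hb₁, hb₂]
  · intro h2 r hr
    obtain rfl : a = 1 := by linarith
    have hP0 : IsBesselPair 0 W W' p q := by simpa using hP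
    have hone := hP0.scatteringSymbol_eq_one hr
    ext i j
    simp only [hone]
    fin_cases i <;> fin_cases j <;> simp [hb₁, hb₂, dataWeight, radialBracket]
    ring

variable {n : ℕ}

/-! ### Dominated convergence, differentiation and multiplication in L² -/

section L2Tools

lemma L2_norm_sq (f : L2 n) : ‖f‖ ^ 2 = ∫ η, ‖f η‖ ^ 2 := by
  have h : (inner ℂ f f : ℂ) = ((‖f‖ ^ 2 : ℝ) : ℂ) := by
    rw [inner_self_eq_norm_sq_to_K]; norm_cast
  rw [L2.inner_def] at h
  have h2 : ∀ η, (inner ℂ (f η) (f η) : ℂ) = ((‖f η‖ ^ 2 : ℝ) : ℂ) := fun η => by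
    rw [inner_self_eq_norm_sq_to_K]; norm_cast
  simp only [h2] at h
  rw [integral_complex_ofReal] at h
  exact_mod_cast h.symm

/-- Dominated convergence in `L²`. -/
theorem tendsto_L2_of_dominated {ι : Type*} {l : Filter ι} [l.IsCountablyGenerated]
    {F : ι → L2 n} {G : L2 n} {f : ι → Space n → ℂ} {h : Space n → ℂ} {g : Space n → ℝ}
    (hF : ∀ᶠ i in l, F i =ᵐ[volume] f i) (hG : G =ᵐ[volume] h) (hg : MemLp g 2 volume)
    (hbound : ∀ᶠ i in l, ∀ᵐ η, ‖f i η‖ ≤ g η)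
    (hlim : ∀ᵐ η, Tendsto (fun i => f i η) l (𝓝 (h η))) : Tendsto F l (𝓝 G) := by
  rw [tendsto_iff_norm_sub_tendsto_zero]
  have key : Tendsto (fun i => ∫ η, ‖(F i - G : L2 n) η‖ ^ 2) l (𝓝 (∫ _ : Space n, (0 : ℝ))) := by
    have hlim' : Tendsto (fun i => ∫ η, ‖f i η - h η‖ ^ 2) l (𝓝 (∫ _ : Space n, (0 : ℝ))) := by
      refine tendsto_integral_filter_of_dominated_convergence
        (fun η => (g η + ‖G η‖) ^ 2) ?_ ?_ ?_ ?_
      · filter_upwards [hF] with i hi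
        have h1 := (Lp.aestronglyMeasurable (F i)).congr hi
        have h2 := (Lp.aestronglyMeasurable G).congr hG
        exact ((h1.sub h2).norm).pow 2
      · filter_upwards [hbound] with i hi
        filter_upwards [hi, hG] with η h1 h2
        rw [Real.norm_of_nonneg (by positivity), h2]
        gcongr
        exact (norm_sub_le _ _).trans (by gcongr)
      · exact (hg.add (Lp.memLp G).norm).integrable_sq
      · filter_upwards [hlim] with η hη
        have := ((hη.sub_const (h η)).norm).pow 2
        simpa using this
    refine hlim'.congr' ?_
    filter_upwards [hF] with i hi
    refine integral_congr_ae ?_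
    filter_upwards [hi, hG, Lp.coeFn_sub (F i) G] with η h1 h2 h3
    rw [h3, Pi.sub_apply, h1, h2]
  simp only [← L2_norm_sq, integral_zero] at key
  have := key.sqrt
  simpa [Real.sqrt_sq (norm_nonneg _)] using this

/-- A difference quotient is bounded by a bound of the derivative. -/
lemma norm_slope_le {E : Type*} [NormedAddCommGroup E] [NormedSpace ℝ E] {f f' : ℝ → E} {C : ℝ}
    (hf : ∀ t, 0 ≤ t → HasDerivWithinAt f (f' t) (Set.Ici 0) t)
    (hC : ∀ t, 0 ≤ t → ‖f' t‖ ≤ C) {s t : ℝ} (hs : 0 ≤ s) (ht : 0 ≤ t) :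
    ‖(t - s)⁻¹ • (f t - f s)‖ ≤ C := by
  have hC0 : 0 ≤ C := (norm_nonneg _).trans (hC 0 le_rfl)
  rcases eq_or_ne t s with rfl | hne
  · simpa using hC0
  have h := Convex.norm_image_sub_le_of_norm_hasDerivWithin_le (s := Set.Ici 0)
    (fun t ht => hf t ht) (fun t ht => hC t ht) (convex_Ici 0) (Set.mem_Ici.2 hs)
    (Set.mem_Ici.2 ht)
  have hpos : 0 < ‖t - s‖ := norm_pos_iff.2 (sub_ne_zero.2 hne)
  rw [norm_smul, norm_inv, inv_mul_le_iff₀ hpos]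
  linarith

/-- Differentiation in `L²` of functions that are differentiable almost everywhere. -/
theorem hasDerivWithinAt_L2 {F G : ℝ → L2 n} {f f' : ℝ → Space n → ℂ} {g : Space n → ℝ}
    (hF : ∀ t, 0 ≤ t → F t =ᵐ[volume] f t) (hG : ∀ t, 0 ≤ t → G t =ᵐ[volume] f' t)
    (hg : MemLp g 2 volume)
    (hd : ∀ᵐ η, ∀ t, 0 ≤ t → HasDerivWithinAt (fun t => f t η) (f' t η) (Set.Ici 0) t)
    (hb : ∀ᵐ η, ∀ t, 0 ≤ t → ‖f' t η‖ ≤ g η) {t : ℝ} (ht : 0 ≤ t) :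
    HasDerivWithinAt F (G t) (Set.Ici 0) t := by
  rw [hasDerivWithinAt_iff_tendsto_slope]
  have hmem : ∀ᶠ s in 𝓝[Set.Ici 0 \ {t}] t, 0 ≤ s :=
    eventually_nhdsWithin_of_forall fun s hs => hs.1
  refine tendsto_L2_of_dominated (f := fun s η => (s - t)⁻¹ • (f s η - f t η)) ?_ (hG t ht) hg ?_ ?_
  · filter_upwards [hmem] with s hs
    filter_upwards [Lp.coeFn_smul ((s - t)⁻¹) (F s - F t), Lp.coeFn_sub (F s) (F t), hF s hs,
      hF t ht] with η h1 h2 h3 h4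
    rw [slope, vsub_eq_sub, h1, Pi.smul_apply, h2, Pi.sub_apply, h3, h4]
  · filter_upwards [hmem] with s hs
    filter_upwards [hd, hb] with η h1 h2
    exact norm_slope_le h1 h2 ht hs
  · filter_upwards [hd] with η h1
    exact hasDerivWithinAt_iff_tendsto_slope.1 (h1 t ht)

/-- Differentiation under the integral sign. -/
theorem hasDerivWithinAt_integral {f f' : ℝ → Space n → ℂ} {g : Space n → ℝ}
    (hf : ∀ t, 0 ≤ t → Integrable (f t)) (hg : Integrable g)
    (hd : ∀ᵐ η, ∀ t, 0 ≤ t → HasDerivWithinAt (fun t => f t η) (f' t η) (Set.Ici 0) t)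
    (hb : ∀ᵐ η, ∀ t, 0 ≤ t → ‖f' t η‖ ≤ g η) {t : ℝ} (ht : 0 ≤ t) :
    HasDerivWithinAt (fun t => ∫ η, f t η) (∫ η, f' t η) (Set.Ici 0) t := by
  rw [hasDerivWithinAt_iff_tendsto_slope]
  have hmem : ∀ᶠ s in 𝓝[Set.Ici 0 \ {t}] t, 0 ≤ s :=
    eventually_nhdsWithin_of_forall fun s hs => hs.1
  have : Tendsto (fun s => ∫ η, (s - t)⁻¹ • (f s η - f t η)) (𝓝[Set.Ici 0 \ {t}] t)
      (𝓝 (∫ η, f' t η)) := by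
    refine tendsto_integral_filter_of_dominated_convergence g ?_ ?_ hg ?_
    · filter_upwards [hmem] with s hs
      exact (((hf s hs).sub (hf t ht)).smul (s - t)⁻¹).aestronglyMeasurable
    · filter_upwards [hmem] with s hs
      filter_upwards [hd, hb] with η h1 h2
      exact norm_slope_le h1 h2 ht hs
    · filter_upwards [hd] with η h1
      exact hasDerivWithinAt_iff_tendsto_slope.1 (h1 t ht)
  refine this.congr' ?_
  filter_upwards [hmem] with s hs
  rw [slope, vsub_eq_sub, integral_smul, integral_sub (hf s hs) (hf t ht)]

/-- Multiplication by a bounded measurable function. -/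
theorem exists_mul_clm (m : Space n → ℂ) (hm : AEStronglyMeasurable m volume) {C : ℝ}
    (hC : ∀ᵐ η, ‖m η‖ ≤ C) :
    ∃ T : L2 n →L[ℂ] L2 n, ∀ f, T f =ᵐ[volume] fun η => m η * f η := by
  have hmem : ∀ f : L2 n, MemLp (fun η => m η * f η) 2 volume := fun f =>
    (Lp.memLp f).of_le_mul (c := C) (hm.mul (Lp.aestronglyMeasurable f)) (by
      filter_upwards [hC] with η h
      rw [norm_mul]
      gcongr)
  let T : L2 n →ₗ[ℂ] L2 n :=
    { toFun := fun f => (hmem f).toLp _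
      map_add' := fun f g => by
        refine Lp.ext ?_
        filter_upwards [(hmem (f + g)).coeFn_toLp, (hmem f).coeFn_toLp, (hmem g).coeFn_toLp,
          Lp.coeFn_add f g, Lp.coeFn_add ((hmem f).toLp _) ((hmem g).toLp _)] with η h1 h2 h3 h4 h5
        rw [h1, h5, Pi.add_apply, h2, h3, h4, Pi.add_apply, mul_add]
      map_smul' := fun c f => by
        refine Lp.ext ?_
        filter_upwards [(hmem (c • f)).coeFn_toLp, (hmem f).coeFn_toLp,
          Lp.coeFn_smul c f, Lp.coeFn_smul c ((hmem f).toLp _)] with η h1 h2 h3 h4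
        simp only [RingHom.id_apply]
        rw [h1, h4, Pi.smul_apply, h2, h3, Pi.smul_apply, smul_eq_mul, smul_eq_mul]
        ring }
  refine ⟨T.mkContinuous C fun f => ?_, fun f => (hmem f).coeFn_toLp⟩
  refine Lp.norm_le_mul_norm_of_ae_le_mul ?_
  filter_upwards [(hmem f).coeFn_toLp, hC] with η h1 h2
  change ‖(hmem f).toLp _ η‖ ≤ _
  rw [h1, norm_mul]
  gcongr

end L2Tools

/-! ### Matrix Fourier multipliers and uniqueness of symbols -/

section Symbols

/-- A bounded measurable symbol defines an operator on pairs. -/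
theorem exists_hasSymbol (M : Space n → Matrix (Fin 2) (Fin 2) ℂ)
    (hM : ∀ i j, AEStronglyMeasurable (fun η : Space n => M ((2 * Real.pi) • η) i j) volume)
    {C : ℝ} (hC : ∀ i j, ∀ᵐ η : Space n, ‖M ((2 * Real.pi) • η) i j‖ ≤ C) :
    ∃ T : Pair n →L[ℂ] Pair n, HasSymbol T M := by
  choose m hm using fun i j => exists_mul_clm _ (hM i j) (hC i j)
  let Φ : L2 n →L[ℂ] L2 n := (Lp.fourierTransformₗᵢ (Space n) ℂ).toContinuousLinearEquiv
  let Ψ : L2 n →L[ℂ] L2 n := (Lp.fourierTransformₗᵢ (Space n) ℂ).symm.toContinuousLinearEquiv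
  refine ⟨ContinuousLinearMap.pi fun i => Ψ.comp (∑ j, ((m i j).comp Φ).comp
    (ContinuousLinearMap.proj j)), fun f i => ?_⟩
  have h : (𝓕 ((ContinuousLinearMap.pi fun i => Ψ.comp (∑ j, ((m i j).comp Φ).comp
      (ContinuousLinearMap.proj (φ := fun _ : Fin 2 => L2 n) j))) f i) : L2 n) =
      m i 0 (𝓕 (f 0)) + m i 1 (𝓕 (f 1)) := by
    rw [← Fin.sum_univ_two (fun j => m i j (𝓕 (f j)))]
    change (Lp.fourierTransformₗᵢ (Space n) ℂ) ((Lp.fourierTransformₗᵢ (Space n) ℂ).symm _) = _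
    rw [LinearIsometryEquiv.apply_symm_apply]
    simp
    rfl
  rw [h]
  filter_upwards [Lp.coeFn_add (m i 0 (𝓕 (f 0))) (m i 1 (𝓕 (f 1))), hm i 0 (𝓕 (f 0)),
    hm i 1 (𝓕 (f 1))] with η h1 h2 h3
  rw [h1, Pi.add_apply, h2, h3, Fin.sum_univ_two]

lemma fourier_injective : Function.Injective (fun f : L2 n => (𝓕 f : L2 n)) :=
  (Lp.fourierTransformₗᵢ (Space n) ℂ).injective

lemma HasSymbol.unique {T T' : Pair n →L[ℂ] Pair n} {M : Space n → Matrix (Fin 2) (Fin 2) ℂ}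
    (h : HasSymbol T M) (h' : HasSymbol T' M) : T = T' := by
  ext1 f
  funext i
  refine fourier_injective (Lp.ext ?_)
  filter_upwards [h f i, h' f i] with η h1 h2
  rw [h1, h2]

lemma exists_L2_ne_zero : ∃ g : L2 n, ∀ᵐ η, g η ≠ 0 := by
  have hint : Integrable (fun η : Space n => (Real.exp (-‖η‖ ^ 2)) ^ 2) := by
    have h := GaussianFourier.integrable_cexp_neg_mul_sq_norm_add (V := Space n) (b := 2)
      (by norm_num) 0 0
    refine h.norm.congr (Eventually.of_forall fun η => ?_)
    simp only [zero_mul, add_zero, Complex.norm_exp]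
    rw [← Real.exp_nat_mul]
    congr 1
    norm_cast
    simp
  have hmem : MemLp (fun η : Space n => ((Real.exp (-‖η‖ ^ 2) : ℝ) : ℂ)) 2 volume := by
    have hcont : Continuous fun η : Space n => Real.exp (-‖η‖ ^ 2) := by fun_prop
    exact ((memLp_two_iff_integrable_sq hcont.aestronglyMeasurable).2 hint).ofReal
  refine ⟨hmem.toLp _, ?_⟩
  filter_upwards [hmem.coeFn_toLp] with η h
  rw [h]
  exact_mod_cast (Real.exp_pos _).ne'

/-- The symbol of an operator is unique almost everywhere. -/
lemma HasSymbol.ae_eq {T : Pair n →L[ℂ] Pair n} {M M' : Space n → Matrix (Fin 2) (Fin 2) ℂ}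
    (h : HasSymbol T M) (h' : HasSymbol T M') :
    ∀ᵐ η : Space n, M ((2 * Real.pi) • η) = M' ((2 * Real.pi) • η) := by
  obtain ⟨g, hg⟩ := exists_L2_ne_zero (n := n)
  have key : ∀ i j : Fin 2, ∀ᵐ η : Space n,
      M ((2 * Real.pi) • η) i j = M' ((2 * Real.pi) • η) i j := by
    intro i j
    -- A pair whose only nonzero component has an almost nowhere vanishing transform isolates the
    -- (i, j) entry.
    let f : Pair n := Pi.single j (𝓕⁻ g)
    have hfj : (𝓕 (f j) : L2 n) = g := by
      simp only [f, Pi.single_eq_same]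
      exact FourierTransform.fourier_fourierInv_eq g
    have hfk : ∀ k, k ≠ j → (𝓕 (f k) : L2 n) = 0 := by
      intro k hk
      simp only [f, Pi.single_eq_of_ne hk]
      exact (Lp.fourierTransformₗᵢ (Space n) ℂ).map_zero
    have hsum : ∀ M : Space n → Matrix (Fin 2) (Fin 2) ℂ, ∀ᵐ η : Space n,
        ∑ k, M ((2 * Real.pi) • η) i k * (𝓕 (f k) : L2 n) η = M ((2 * Real.pi) • η) i j * g η := by
      intro M
      filter_upwards [Lp.coeFn_zero (E := ℂ) (p := 2) (μ := (volume : Measure (Space n)))] with η h0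
      rw [Finset.sum_eq_single j, hfj]
      · intro k _ hk
        rw [hfk k hk, h0, Pi.zero_apply, mul_zero]
      · simp
    filter_upwards [h f i, h' f i, hsum M, hsum M', hg] with η h1 h2 h3 h4 h5
    rw [h1, h3, h4] at h2
    exact mul_right_cancel₀ h5 h2
  filter_upwards [key 0 0, key 0 1, key 1 0, key 1 1] with η h1 h2 h3 h4
  ext i j
  fin_cases i <;> fin_cases j
  exacts [h1, h2, h3, h4]

lemma two_pi_ne_zero : (2 * Real.pi) ≠ 0 := by positivity

/-- An almost everywhere equality of continuous functions on an open set holds everywhere there.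
This is what makes pointwise statements about the symbol meaningful. -/
lemma HasSymbol.eqOn {T : Pair n →L[ℂ] Pair n} {M M' : Space n → Matrix (Fin 2) (Fin 2) ℂ}
    (h : HasSymbol T M) (h' : HasSymbol T M') (hM : ContinuousOn M {0}ᶜ)
    (hM' : ContinuousOn M' {0}ᶜ) : Set.EqOn M M' {0}ᶜ := by
  have hmaps : Set.MapsTo (fun η : Space n => (2 * Real.pi) • η) {0}ᶜ {0}ᶜ := fun η hη =>
    smul_ne_zero two_pi_ne_zero hη
  have hcont : Continuous fun η : Space n => (2 * Real.pi) • η := by fun_prop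
  have key := MeasureTheory.Measure.eqOn_open_of_ae_eq (μ := (volume : Measure (Space n)))
    (f := fun η => M ((2 * Real.pi) • η)) (g := fun η => M' ((2 * Real.pi) • η))
    (ae_restrict_of_ae (h.ae_eq h')) isOpen_compl_singleton
    (hM.comp hcont.continuousOn hmaps) (hM'.comp hcont.continuousOn hmaps)
  intro ξ hξ
  have := key (x := (2 * Real.pi)⁻¹ • ξ) (smul_ne_zero (inv_ne_zero two_pi_ne_zero) hξ)
  simpa only [smul_inv_smul₀ two_pi_ne_zero] using this

lemma IsMultiplier.unique {m : Space n → ℝ} {f g g' : L2 n} (h : IsMultiplier m f g)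
    (h' : IsMultiplier m f g') : g = g' := by
  refine fourier_injective (Lp.ext ?_)
  filter_upwards [h, h'] with η h1 h2
  rw [h1, h2]

lemma IsMultiplier.unique_left {m : Space n → ℝ} (hm : ∀ ξ, m ξ ≠ 0) {f f' g : L2 n}
    (h : IsMultiplier m f g) (h' : IsMultiplier m f' g) : f = f' := by
  refine fourier_injective (Lp.ext ?_)
  filter_upwards [h, h'] with η h1 h2
  rw [h1] at h2
  exact mul_left_cancel₀ (Complex.ofReal_ne_zero.2 (hm _)) h2

end Symbols

/-! ### Tempered distributions paired on the Fourier side -/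

section Pairing

lemma pairing_eq (f : L2 n) (φ : 𝓢(Space n, ℂ)) :
    (f : 𝓢'(Space n, ℂ)) φ = ∫ η, (𝓕⁻ φ) η * (𝓕 f : L2 n) η := by
  have h : (f : 𝓢'(Space n, ℂ)) φ = ((𝓕 f : L2 n) : 𝓢'(Space n, ℂ)) (𝓕⁻ φ) := by
    rw [← Lp.fourier_toTemperedDistribution_eq, TemperedDistribution.fourier_apply,
      FourierTransform.fourier_fourierInv_eq]
  rw [h, Lp.toTemperedDistribution_apply]
  simp only [smul_eq_mul]

/-- Computed for `𝓕` and transferred by the reflection η ↦ -η, under which the symbol is invariant.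
-/
lemma fourierInv_laplacian (φ : 𝓢(Space n, ℂ)) (η : Space n) :
    (𝓕⁻ (Δ φ)) η = -((‖(2 * Real.pi) • η‖ ^ 2 : ℝ) : ℂ) * (𝓕⁻ φ) η := by
  have h : ∀ x, (𝓕 (Δ φ)) x = -((‖(2 * Real.pi) • x‖ ^ 2 : ℝ) : ℂ) * (𝓕 φ) x := by
    intro x
    have hg : (fun x : Space n => ‖x‖ ^ 2).HasTemperateGrowth := by fun_prop
    rw [SchwartzMap.laplacian_eq_fourierMultiplierCLM, FourierTransform.fourier_smul,
      SchwartzMap.fourierMultiplierCLM_apply, FourierTransform.fourier_fourierInv_eq,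
      smul_apply, SchwartzMap.smulLeftCLM_apply_apply hg, norm_smul,
      Real.norm_of_nonneg (by positivity : 0 ≤ 2 * Real.pi)]
    simp only [Complex.real_smul]
    push_cast
    ring
  rw [SchwartzMap.fourierInv_apply_eq, SchwartzMap.fourierInv_apply_eq]
  simp [h]

lemma pairing_laplacian_eq (f : L2 n) (φ : 𝓢(Space n, ℂ)) :
    (Δ (f : 𝓢'(Space n, ℂ))) φ =
      ∫ η, -((‖(2 * Real.pi) • η‖ ^ 2 : ℝ) : ℂ) * (𝓕⁻ φ) η * (𝓕 f : L2 n) η := by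
  rw [TemperedDistribution.laplacian_apply_apply, pairing_eq]
  simp only [fourierInv_laplacian]

end Pairing

/-! ### Existence for the Cauchy problem -/

/-- The modulus of the angular frequency. -/
def freqNorm (η : Space n) : ℝ := ‖(2 * Real.pi) • η‖

lemma continuous_freqNorm : Continuous (freqNorm (n := n)) := by
  unfold freqNorm; fun_prop

/-- For n ≥ 1 the origin is a null set, so the fundamental system is only needed for r > 0. -/
lemma ae_freqNorm_pos (hn : 1 ≤ n) : ∀ᵐ η : Space n, 0 < freqNorm η := by
  have : Nonempty (Fin n) := ⟨⟨0, hn⟩⟩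
  have h : ∀ᵐ η : Space n, η ≠ 0 := by
    rw [ae_iff]
    simp
  filter_upwards [h] with η hη
  exact norm_pos_iff.2 (smul_ne_zero two_pi_ne_zero hη)

lemma japanese_smul (η : Space n) :
    japanese ((2 * Real.pi) • η) = Real.sqrt (1 + freqNorm η ^ 2) := rfl

namespace IsFundamental

variable {μ : ℝ} {Y Y' : Fin 2 → ℝ → ℝ → ℝ}

lemma abs_le (h : IsFundamental μ Y Y') (hμ : 0 ≤ μ) {r t : ℝ} (hr : 0 < r) (ht : 0 ≤ t) :
    |Y 0 r t| ≤ 1 ∧ |Y' 0 r t| ≤ r ∧ r * |Y 1 r t| ≤ 1 ∧ |Y' 1 r t| ≤ 1 := by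
  have e0 := (h.isWave 0 r hr).energy_le hμ ht
  have e1 := (h.isWave 1 r hr).energy_le hμ ht
  simp only [h.initial_value _ r hr, h.initial_deriv _ r hr, Matrix.cons_val_zero,
    Matrix.cons_val_one, mul_one, mul_zero, ne_eq, OfNat.ofNat_ne_zero, not_false_eq_true,
    zero_pow, add_zero, zero_add, one_pow] at e0 e1
  have f1 : |r * Y 0 r t| ≤ r := abs_le_of_sq_le_sq (by nlinarith [sq_nonneg (Y' 0 r t)]) hr.le
  have f3 : |r * Y 1 r t| ≤ 1 :=
    abs_le_of_sq_le_sq (by nlinarith [sq_nonneg (Y' 1 r t)]) zero_le_one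
  rw [abs_mul, abs_of_pos hr] at f1 f3
  refine ⟨?_, abs_le_of_sq_le_sq (by nlinarith [sq_nonneg (r * Y 0 r t)]) hr.le, f3,
    abs_le_of_sq_le_sq (by nlinarith [sq_nonneg (r * Y 1 r t)]) zero_le_one⟩
  exact le_of_mul_le_mul_left (f1.trans_eq (mul_one r).symm) hr

/-- Needed at low frequencies, where the energy bound r |Y 1| ≤ 1 degenerates. -/
lemma abs_snd_le (h : IsFundamental μ Y Y') (hμ : 0 ≤ μ) {r t : ℝ} (hr : 0 < r) (ht : 0 ≤ t) :
    |Y 1 r t| ≤ t := by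
  have := Convex.norm_image_sub_le_of_norm_hasDerivWithin_le (C := 1) (s := Set.Ici 0) (x := 0)
    (y := t) (fun t ht => ((h.isWave 1 r hr).hasDerivAt t ht).hasDerivWithinAt)
    (fun t ht => (h.abs_le hμ hr ht).2.2.2) (convex_Ici 0) (Set.mem_Ici.2 le_rfl) ht
  simpa [h.initial_value 1 r hr, abs_of_nonneg ht] using this

end IsFundamental

/-- The superposition of the functions `Y 0` and `Y 1` with coefficients depending on the
frequency. -/
def superpose (Y : Fin 2 → ℝ → ℝ → ℝ) (A B : Space n → ℂ) (t : ℝ) (η : Space n) : ℂ :=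
  (Y 0 (freqNorm η) t : ℂ) * A η + (Y 1 (freqNorm η) t : ℂ) * B η

lemma norm_superpose_le (Y : Fin 2 → ℝ → ℝ → ℝ) (A B : Space n → ℂ) (t : ℝ) (η : Space n) :
    ‖superpose Y A B t η‖ ≤ |Y 0 (freqNorm η) t| * ‖A η‖ + |Y 1 (freqNorm η) t| * ‖B η‖ := by
  refine (norm_add_le _ _).trans (le_of_eq ?_)
  rw [norm_mul, norm_mul, Complex.norm_real, Complex.norm_real, Real.norm_eq_abs,
    Real.norm_eq_abs]

section Existence

variable {μ : ℝ} {Y Y' : Fin 2 → ℝ → ℝ → ℝ}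

lemma aestronglyMeasurable_superpose (hY : ∀ j t, Measurable fun r => Y j r t)
    {A B : Space n → ℂ} (hA : AEStronglyMeasurable A volume)
    (hB : AEStronglyMeasurable B volume) (t : ℝ) :
    AEStronglyMeasurable (superpose Y A B t) volume := by
  have h : ∀ j, AEStronglyMeasurable (fun η : Space n => (Y j (freqNorm η) t : ℂ)) volume :=
    fun j => (Complex.measurable_ofReal.comp
      ((hY j t).comp continuous_freqNorm.measurable)).aestronglyMeasurable
  exact ((h 0).mul hA).add ((h 1).mul hB)

/-- The frequency side of the solutions is dominated by square integrable functions. -/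
lemma norm_superpose_bounds (hn : 1 ≤ n) (hμ : 0 ≤ μ) (hY : IsFundamental μ Y Y')
    {A B G : Space n → ℂ} (hGA : ∀ᵐ η, ‖G η‖ = Real.sqrt (1 + freqNorm η ^ 2) * ‖A η‖) :
    (∀ᵐ η, ∀ t, 0 ≤ t → ‖superpose Y A B t η‖ ≤ ‖A η‖ + t * ‖B η‖) ∧
    (∀ᵐ η, ∀ t, 0 ≤ t → ‖(Real.sqrt (1 + freqNorm η ^ 2) : ℂ) * superpose Y A B t η‖ ≤
      ‖G η‖ + (1 + t) * ‖B η‖) ∧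
    (∀ᵐ η, ∀ t, 0 ≤ t → ‖superpose Y' A B t η‖ ≤ ‖G η‖ + ‖B η‖) ∧
    (∀ᵐ η, ∀ t, 0 ≤ t →
      freqNorm η ^ 2 * ‖superpose Y A B t η‖ ≤ (1 + freqNorm η ^ 2) * (‖G η‖ + ‖B η‖)) := by
  have hpos := ae_freqNorm_pos hn
  set j : Space n → ℝ := fun η => Real.sqrt (1 + freqNorm η ^ 2) with hj
  have hj1 : ∀ η, 1 ≤ j η := fun η => one_le_sqrt_one_add_sq _
  have hjr : ∀ η, freqNorm η ≤ j η := fun η => le_sqrt_one_add_sq _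
  have hjr' : ∀ η, j η ≤ 1 + freqNorm η := fun η => by
    have : 0 ≤ freqNorm η := norm_nonneg _
    rw [hj, Real.sqrt_le_left (by linarith)]
    nlinarith
  have bU : ∀ᵐ η, ∀ t, 0 ≤ t → ‖superpose Y A B t η‖ ≤ ‖A η‖ + t * ‖B η‖ := by
    filter_upwards [hpos] with η hη t ht
    refine (norm_superpose_le _ _ _ _ _).trans ?_
    have h1 := (hY.abs_le hμ hη ht).1
    have h2 := hY.abs_snd_le hμ hη ht
    gcongr
    exact mul_le_of_le_one_left (norm_nonneg _) h1
  have bW : ∀ᵐ η, ∀ t, 0 ≤ t → ‖(j η : ℂ) * superpose Y A B t η‖ ≤ ‖G η‖ + (1 + t) * ‖B η‖ := by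
    filter_upwards [hpos, hGA] with η hη hGA t ht
    rw [norm_mul, Complex.norm_real, Real.norm_of_nonneg (Real.sqrt_nonneg _)]
    obtain ⟨h1, -, h3, -⟩ := hY.abs_le hμ hη ht
    have h2 := hY.abs_snd_le hμ hη ht
    -- Here √(1+r²) ≤ 1 + r splits the weight: |Y 1| ≤ t handles the first summand and r |Y 1| ≤ 1
    -- the second.
    have h4 : j η * |Y 1 (freqNorm η) t| ≤ 1 + t := by
      have := mul_le_mul_of_nonneg_right (hjr' η) (abs_nonneg (Y 1 (freqNorm η) t))
      linarith
    calc j η * ‖superpose Y A B t η‖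
        ≤ j η * (|Y 0 (freqNorm η) t| * ‖A η‖ + |Y 1 (freqNorm η) t| * ‖B η‖) := by
          have := (hj1 η)
          gcongr
          exact norm_superpose_le _ _ _ _ _
      _ = |Y 0 (freqNorm η) t| * (j η * ‖A η‖) + j η * |Y 1 (freqNorm η) t| * ‖B η‖ := by ring
      _ ≤ 1 * (j η * ‖A η‖) + (1 + t) * ‖B η‖ := by
          have : 0 ≤ j η * ‖A η‖ := mul_nonneg (by linarith [hj1 η]) (norm_nonneg _)
          gcongr
      _ = _ := by rw [one_mul, hGA]
  have bV : ∀ᵐ η, ∀ t, 0 ≤ t → ‖superpose Y' A B t η‖ ≤ ‖G η‖ + ‖B η‖ := by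
    filter_upwards [hpos, hGA] with η hη hGA t ht
    refine (norm_superpose_le _ _ _ _ _).trans ?_
    obtain ⟨-, h2, -, h4⟩ := hY.abs_le hμ hη ht
    rw [hGA]
    gcongr
    · exact h2.trans (hjr η)
    · exact mul_le_of_le_one_left (norm_nonneg _) h4
  have bRU : ∀ᵐ η, ∀ t, 0 ≤ t →
      freqNorm η ^ 2 * ‖superpose Y A B t η‖ ≤ (1 + freqNorm η ^ 2) * (‖G η‖ + ‖B η‖) := by
    filter_upwards [hpos, hGA] with η hη hGA t ht
    obtain ⟨h1, -, h3, -⟩ := hY.abs_le hμ hη ht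
    calc freqNorm η ^ 2 * ‖superpose Y A B t η‖
        ≤ freqNorm η ^ 2 * (|Y 0 (freqNorm η) t| * ‖A η‖ + |Y 1 (freqNorm η) t| * ‖B η‖) := by
          gcongr
          exact norm_superpose_le _ _ _ _ _
      _ = freqNorm η ^ 2 * (|Y 0 (freqNorm η) t| * ‖A η‖) +
          freqNorm η * (freqNorm η * |Y 1 (freqNorm η) t|) * ‖B η‖ := by ring
      _ ≤ (1 + freqNorm η ^ 2) * (1 * ‖G η‖) + (1 + freqNorm η ^ 2) * ‖B η‖ := by
          have hAG : ‖A η‖ ≤ ‖G η‖ := by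
            rw [hGA]; exact le_mul_of_one_le_left (norm_nonneg _) (hj1 η)
          have h5 : freqNorm η * (freqNorm η * |Y 1 (freqNorm η) t|) ≤ 1 + freqNorm η ^ 2 := by
            have := mul_le_mul_of_nonneg_left h3 hη.le
            nlinarith [sq_nonneg (freqNorm η - 1)]
          gcongr
          linarith
      _ = _ := by ring
  exact ⟨bU, bW, bV, bRU⟩

lemma hasDerivWithinAt_superpose (hn : 1 ≤ n) (hY : IsFundamental μ Y Y') (A B : Space n → ℂ) :
    (∀ᵐ η, ∀ t, 0 ≤ t → HasDerivWithinAt (fun t => superpose Y A B t η)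
      (superpose Y' A B t η) (Set.Ici 0) t) ∧
    ∀ᵐ η, ∀ t, 0 ≤ t → HasDerivWithinAt (fun t => superpose Y' A B t η)
      (-((freqNorm η ^ 2 : ℝ) : ℂ) * superpose Y A B t η -
        ((μ / (1 + t) : ℝ) : ℂ) * superpose Y' A B t η) (Set.Ici 0) t := by
  have hpos := ae_freqNorm_pos hn
  have hdU : ∀ᵐ η, ∀ t, 0 ≤ t → HasDerivWithinAt (fun t => superpose Y A B t η)
      (superpose Y' A B t η) (Set.Ici 0) t := by
    filter_upwards [hpos] with η hη t ht
    exact ((((hY.isWave 0 _ hη).hasDerivAt t ht).ofReal_comp.mul_const _).add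
      (((hY.isWave 1 _ hη).hasDerivAt t ht).ofReal_comp.mul_const _)).hasDerivWithinAt
  have hdV : ∀ᵐ η, ∀ t, 0 ≤ t → HasDerivWithinAt (fun t => superpose Y' A B t η)
      (-((freqNorm η ^ 2 : ℝ) : ℂ) * superpose Y A B t η -
        ((μ / (1 + t) : ℝ) : ℂ) * superpose Y' A B t η) (Set.Ici 0) t := by
    filter_upwards [hpos] with η hη t ht
    refine (((((hY.isWave 0 _ hη).hasDerivAt_deriv t ht).ofReal_comp.mul_const _).add
      (((hY.isWave 1 _ hη).hasDerivAt_deriv t ht).ofReal_comp.mul_const _)).congr_deriv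
        ?_).hasDerivWithinAt
    simp only [superpose]
    push_cast
    ring
  exact ⟨hdU, hdV⟩

/-- The pairing of the frequency side of `u_t` with a Schwartz function is differentiable. -/
lemma hasDerivWithinAt_pairing (hn : 1 ≤ n) (hμ : 0 ≤ μ) (hY : IsFundamental μ Y Y')
    {A B G : Space n → ℂ} (hGA : ∀ᵐ η, ‖G η‖ = Real.sqrt (1 + freqNorm η ^ 2) * ‖A η‖)
    (hmG : MemLp G 2 volume) (hmB : MemLp B 2 volume)
    (mV : ∀ t, 0 ≤ t → MemLp (superpose Y' A B t) 2 volume) (φ : 𝓢(Space n, ℂ)) {t : ℝ}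
    (ht : 0 ≤ t) :
    HasDerivWithinAt (fun t => ∫ η, (𝓕⁻ φ) η * superpose Y' A B t η)
      (∫ η, (𝓕⁻ φ) η * (-((freqNorm η ^ 2 : ℝ) : ℂ) * superpose Y A B t η -
        ((μ / (1 + t) : ℝ) : ℂ) * superpose Y' A B t η)) (Set.Ici 0) t := by
  obtain ⟨-, -, bV, bRU⟩ := norm_superpose_bounds hn hμ hY (B := B) hGA
  have hdV := (hasDerivWithinAt_superpose hn hY A B).2
  have hψ : MemLp (fun η => (𝓕⁻ φ) η) 2 volume := (𝓕⁻ φ).memLp 2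
  -- For H¹ data u_tt need not lie in L². The factor r² is moved onto the Schwartz function, where
  -- it becomes the transform of Δφ.
  have hχ : MemLp (fun η => (𝓕⁻ (Δ φ)) η) 2 volume := (𝓕⁻ (Δ φ)).memLp 2
  have hχψ : ∀ η, ‖(𝓕⁻ (Δ φ)) η‖ = freqNorm η ^ 2 * ‖(𝓕⁻ φ) η‖ := fun η => by
    rw [fourierInv_laplacian, norm_mul, norm_neg, Complex.norm_real, Real.norm_of_nonneg
      (by positivity)]
    rfl
  have hGB : MemLp (fun η => ‖G η‖ + ‖B η‖) 2 volume := hmG.norm.add hmB.norm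
  have hint : ∀ s, 0 ≤ s → Integrable (fun η => (𝓕⁻ φ) η * superpose Y' A B s η) :=
    fun s hs => hψ.integrable_mul (mV s hs)
  refine hasDerivWithinAt_integral
    (f := fun s η => (𝓕⁻ φ) η * superpose Y' A B s η)
    (f' := fun s η => (𝓕⁻ φ) η * (-((freqNorm η ^ 2 : ℝ) : ℂ) * superpose Y A B s η -
      ((μ / (1 + s) : ℝ) : ℂ) * superpose Y' A B s η))
    (g := fun η => ((1 + μ) * ‖(𝓕⁻ φ) η‖ + ‖(𝓕⁻ (Δ φ)) η‖) * (‖G η‖ + ‖B η‖)) hint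
    (((hψ.norm.const_mul (1 + μ)).add hχ.norm).integrable_mul hGB) ?_ ?_ ht
  · filter_upwards [hdV] with η h s hs
    exact (h s hs).const_mul _
  · filter_upwards [bRU, bV] with η h1 h2 s hs
    have hs1 : μ / (1 + s) ≤ μ := div_le_self hμ (by linarith)
    have hs0 : 0 ≤ μ / (1 + s) := div_nonneg hμ (by linarith)
    rw [norm_mul]
    calc _ ≤ ‖(𝓕⁻ φ) η‖ * (freqNorm η ^ 2 * ‖superpose Y A B s η‖ +
            μ / (1 + s) * ‖superpose Y' A B s η‖) := by
          gcongr
          refine (norm_sub_le _ _).trans (le_of_eq ?_)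
          rw [norm_mul, norm_mul, norm_neg, Complex.norm_real, Complex.norm_real,
            Real.norm_of_nonneg hs0, Real.norm_of_nonneg (by positivity)]
      _ ≤ ‖(𝓕⁻ φ) η‖ * ((1 + freqNorm η ^ 2) * (‖G η‖ + ‖B η‖) + μ * (‖G η‖ + ‖B η‖)) := by
          refine mul_le_mul_of_nonneg_left (add_le_add (h1 s hs) ?_) (norm_nonneg _)
          exact mul_le_mul hs1 (h2 s hs) (norm_nonneg _) hμ
      _ = _ := by rw [hχψ]; ring

/-- The Cauchy problem has a solution, given by the fundamental system on the Fourier side. -/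
theorem exists_isSolution (hn : 1 ≤ n) (hμ : 0 ≤ μ) (hY : IsFundamental μ Y Y') {u₁ u₂ g₁ : L2 n}
    (hg₁ : IsMultiplier japanese u₁ g₁) :
    ∃ u v, IsSolution μ u₁ u₂ u v ∧ ∀ t, 0 ≤ t →
      (𝓕 (u t) : L2 n) =ᵐ[volume] superpose Y (𝓕 u₁ : L2 n) (𝓕 u₂ : L2 n) t ∧
      (𝓕 (v t) : L2 n) =ᵐ[volume] superpose Y' (𝓕 u₁ : L2 n) (𝓕 u₂ : L2 n) t := by
  obtain ⟨A, hA⟩ : ∃ f : Space n → ℂ, f = ((𝓕 u₁ : L2 n) : Space n → ℂ) := ⟨_, rfl⟩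
  obtain ⟨B, hB⟩ : ∃ f : Space n → ℂ, f = ((𝓕 u₂ : L2 n) : Space n → ℂ) := ⟨_, rfl⟩
  obtain ⟨G, hG⟩ : ∃ f : Space n → ℂ, f = ((𝓕 g₁ : L2 n) : Space n → ℂ) := ⟨_, rfl⟩
  rw [← hA, ← hB]
  have hmA : MemLp A 2 volume := hA ▸ Lp.memLp _
  have hmB : MemLp B 2 volume := hB ▸ Lp.memLp _
  have hmG : MemLp G 2 volume := hG ▸ Lp.memLp _
  have hpos := ae_freqNorm_pos hn
  set j : Space n → ℝ := fun η => Real.sqrt (1 + freqNorm η ^ 2) with hj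
  have hGA : ∀ᵐ η, ‖G η‖ = j η * ‖A η‖ := by
    filter_upwards [hg₁] with η h
    rw [hG, h, hA, japanese_smul, norm_mul, Complex.norm_real,
      Real.norm_of_nonneg (Real.sqrt_nonneg _)]
  have hj_cont : Continuous j := (continuous_sqrt_one_add_sq).comp continuous_freqNorm
  obtain ⟨bU, bW, bV, -⟩ := norm_superpose_bounds hn hμ hY (B := B) hGA
  obtain ⟨hdU, hdV⟩ := hasDerivWithinAt_superpose hn hY A B
  have mU : ∀ t, 0 ≤ t → MemLp (superpose Y A B t) 2 volume := fun t ht =>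
    (hmA.norm.add (hmB.norm.const_mul t)).mono'
      (aestronglyMeasurable_superpose hY.measurable hmA.1 hmB.1 t) (bU.mono fun η h => h t ht)
  have mV : ∀ t, 0 ≤ t → MemLp (superpose Y' A B t) 2 volume := fun t ht =>
    (hmG.norm.add hmB.norm).mono'
      (aestronglyMeasurable_superpose hY.measurable_deriv hmA.1 hmB.1 t)
      (bV.mono fun η h => h t ht)
  have mW : ∀ t, 0 ≤ t → MemLp (fun η => (j η : ℂ) * superpose Y A B t η) 2 volume := fun t ht =>
    (hmG.norm.add (hmB.norm.const_mul (1 + t))).mono'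
      ((Complex.continuous_ofReal.comp hj_cont).aestronglyMeasurable.mul
        (aestronglyMeasurable_superpose hY.measurable hmA.1 hmB.1 t)) (bW.mono fun η h => h t ht)
  have choice : ∀ f : ℝ → Space n → ℂ, (∀ t, 0 ≤ t → MemLp (f t) 2 volume) →
      ∃ F : ℝ → L2 n, ∀ t, 0 ≤ t → F t =ᵐ[volume] f t := by
    intro f hf
    have : ∀ t, ∃ F : L2 n, 0 ≤ t → F =ᵐ[volume] f t := fun t => by
      by_cases ht : 0 ≤ t
      · exact ⟨(hf t ht).toLp _, fun _ => (hf t ht).coeFn_toLp⟩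
      · exact ⟨0, fun h => absurd h ht⟩
    choose F hF using this
    exact ⟨F, hF⟩
  obtain ⟨U, hU⟩ := choice _ mU
  obtain ⟨V, hV⟩ := choice _ mV
  obtain ⟨W, hW⟩ := choice _ mW
  obtain ⟨Ψ, hFΨ⟩ : ∃ Ψ : L2 n ≃ₗᵢ[ℂ] L2 n, ∀ f : L2 n, (𝓕 (Ψ f) : L2 n) = f :=
    ⟨_, (Lp.fourierTransformₗᵢ (Space n) ℂ).apply_symm_apply⟩
  refine ⟨fun t => Ψ (U t), fun t => Ψ (V t), ⟨⟨fun t => Ψ (W t), ?_, ?_⟩, ?_, ?_, ?_, ?_, ?_⟩, ?_⟩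
  · intro t ht
    refine Ψ.continuous.continuousAt.comp_continuousWithinAt ?_
    -- Continuity is local in time, so the bound growing with s may be frozen at s = t + 1.
    refine tendsto_L2_of_dominated (f := fun t η => (j η : ℂ) * superpose Y A B t η)
      (eventually_nhdsWithin_of_forall fun s hs => hW s hs) (hW t ht)
      (g := fun η => ‖G η‖ + (1 + (t + 1)) * ‖B η‖)
      (hmG.norm.add (hmB.norm.const_mul (1 + (t + 1)))) ?_ ?_
    · filter_upwards [self_mem_nhdsWithin,
        mem_nhdsWithin_of_mem_nhds (Iio_mem_nhds (lt_add_one t))] with s hs hs'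
      have hs'' : s ≤ t + 1 := (Set.mem_Iio.1 hs').le
      filter_upwards [bW] with η h
      refine (h s hs).trans ?_
      gcongr
    · filter_upwards [hdU] with η h
      exact (h t ht).continuousWithinAt.const_mul _
  · intro t ht
    change ∀ᵐ η, (𝓕 (Ψ (W t)) : L2 n) η = _ * (𝓕 (Ψ (U t)) : L2 n) η
    rw [hFΨ, hFΨ]
    filter_upwards [hW t ht, hU t ht] with η h1 h2
    rw [h1, h2, japanese_smul]
  · intro t ht
    have h := hasDerivWithinAt_L2 hU hV (hmG.norm.add hmB.norm) hdU bV ht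
    let Ψr : L2 n →L[ℝ] L2 n :=
      (Ψ.toContinuousLinearEquiv : L2 n →L[ℂ] L2 n).restrictScalars ℝ
    exact Ψr.hasFDerivAt.comp_hasDerivWithinAt t h
  · intro t ht
    refine Ψ.continuous.continuousAt.comp_continuousWithinAt ?_
    refine tendsto_L2_of_dominated (f := superpose Y' A B)
      (eventually_nhdsWithin_of_forall fun s hs => hV s hs) (hV t ht)
      (hmG.norm.add hmB.norm) ?_ ?_
    · filter_upwards [self_mem_nhdsWithin] with s hs
      exact bV.mono fun η h => h s hs
    · filter_upwards [hdV] with η h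
      exact (h t ht).continuousWithinAt
  · intro φ t ht
    have hpair : ∀ s, 0 ≤ s → ((Ψ (V s) : L2 n) : 𝓢'(Space n, ℂ)) φ =
        ∫ η, (𝓕⁻ φ) η * superpose Y' A B s η := fun s hs => by
      rw [pairing_eq, hFΨ]
      refine integral_congr_ae ?_
      filter_upwards [hV s hs] with η h
      rw [h]
    have hder := hasDerivWithinAt_pairing hn hμ hY hGA hmG hmB mV φ ht
    have hcongr := hder.congr (f₁ := fun s => ((Ψ (V s) : L2 n) : 𝓢'(Space n, ℂ)) φ)
      (fun s hs => hpair s hs) (hpair t ht)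
    refine hcongr.congr_deriv ?_
    rw [pairing_laplacian_eq, hFΨ, hpair t ht, ← integral_const_mul, ← integral_sub]
    · refine integral_congr_ae ?_
      filter_upwards [hU t ht] with η h
      rw [h]
      simp only [freqNorm]
      ring
    · have : Integrable fun η => (𝓕⁻ (Δ φ)) η * (U t : Space n → ℂ) η :=
        ((𝓕⁻ (Δ φ)).memLp 2).integrable_mul (Lp.memLp (U t))
      simpa only [fourierInv_laplacian] using this
    · exact ((((𝓕⁻ φ).memLp 2)).integrable_mul (mV t ht)).const_mul _
  · refine fourier_injective (Lp.ext ?_)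
    simp only [hFΨ]
    filter_upwards [hU 0 le_rfl, hpos] with η h1 h2
    rw [h1, superpose, hY.initial_value 0 _ h2, hY.initial_value 1 _ h2]
    simp [hA]
  · refine fourier_injective (Lp.ext ?_)
    simp only [hFΨ]
    filter_upwards [hV 0 le_rfl, hpos] with η h1 h2
    rw [h1, superpose, hY.initial_deriv 0 _ h2, hY.initial_deriv 1 _ h2]
    simp [hB]
  · intro t ht
    simp only [hFΨ]
    exact ⟨hU t ht, hV t ht⟩

end Existence

/-! ### Uniqueness for the Cauchy problem -/

section Uniqueness

/-- Integration of the damped inequality `|f' + μ / (1 + t) f| ≤ c R (R t)^k / k!`. -/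
lemma norm_le_of_damped_deriv {f f' : ℝ → ℂ} {μ c R T : ℝ} (hμ : 0 ≤ μ) (hc : 0 ≤ c) (hR : 0 ≤ R)
    (k : ℕ) (h0 : f 0 = 0) (hf : ∀ t, 0 ≤ t → HasDerivWithinAt f (f' t) (Set.Ici 0) t)
    (hb : ∀ t ∈ Set.Icc 0 T, ‖f' t + ((μ / (1 + t) : ℝ) : ℂ) * f t‖ ≤
      c * R * ((R * t) ^ k / k.factorial)) {t : ℝ} (ht : t ∈ Set.Icc 0 T) :
    ‖f t‖ ≤ c * ((R * t) ^ (k + 1) / (k + 1).factorial) := by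
  have hw : ∀ t : ℝ, 0 ≤ t →
      HasDerivAt (fun t : ℝ => (1 + t) ^ μ) (μ / (1 + t) * (1 + t) ^ μ) t := by
    intro t ht
    have hx : 0 < 1 + t := by linarith
    refine (((hasDerivAt_id t).const_add 1).rpow_const (p := μ) (Or.inl hx.ne')).congr_deriv ?_
    simp only [id]
    rw [Real.rpow_sub_one hx.ne']
    ring
  have hp : ∀ t : ℝ, HasDerivAt (fun t : ℝ => c * ((R * t) ^ (k + 1) / (k + 1).factorial))
      (c * R * ((R * t) ^ k / k.factorial)) t := by
    intro t
    have h := ((((hasDerivAt_id t).const_mul R).pow (k + 1)).div_const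
      ((k + 1).factorial : ℝ)).const_mul c
    refine h.congr_deriv ?_
    have h1 : (k.factorial : ℝ) ≠ 0 := by positivity
    rw [Nat.factorial_succ]
    simp
    field_simp
  have hF : ∀ t, 0 ≤ t → HasDerivWithinAt (fun t => (((1 + t) ^ μ : ℝ) : ℂ) * f t)
      ((((1 + t) ^ μ : ℝ) : ℂ) * (f' t + ((μ / (1 + t) : ℝ) : ℂ) * f t)) (Set.Ici 0) t := by
    intro t ht
    refine ((hw t ht).ofReal_comp.hasDerivWithinAt.mul (hf t ht)).congr_deriv ?_
    push_cast
    ring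
  have hB : ∀ t, 0 ≤ t → HasDerivAt
      (fun t => (1 + t) ^ μ * (c * ((R * t) ^ (k + 1) / (k + 1).factorial)))
      (μ / (1 + t) * (1 + t) ^ μ * (c * ((R * t) ^ (k + 1) / (k + 1).factorial)) +
        (1 + t) ^ μ * (c * R * ((R * t) ^ k / k.factorial))) t :=
    fun t ht => (hw t ht).mul (hp t)
  -- The integrating factor (1+t)^μ removes the damping. It also multiplies the comparison function,
  -- and as it is increasing it only adds a nonnegative term to that derivative.
  have key := image_norm_le_of_norm_deriv_right_le_deriv_boundary' (a := 0) (b := T)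
    (f := fun t => (((1 + t) ^ μ : ℝ) : ℂ) * f t)
    (fun t ht => (hF t ht.1).continuousWithinAt.mono fun s hs => hs.1)
    (fun t ht => (hF t ht.1).mono (Set.Ici_subset_Ici.2 ht.1))
    (B := fun t => (1 + t) ^ μ * (c * ((R * t) ^ (k + 1) / (k + 1).factorial)))
    (by simp [h0]) (fun t ht => (hB t ht.1).continuousAt.continuousWithinAt)
    (fun t ht => (hB t ht.1).hasDerivWithinAt) ?_ ht
  · have hx : 0 < (1 + t) ^ μ := Real.rpow_pos_of_pos (by linarith [ht.1]) μ
    rw [norm_mul, Complex.norm_real, Real.norm_of_nonneg hx.le] at key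
    exact le_of_mul_le_mul_left key hx
  · intro s hs
    have hs0 : 0 ≤ s := hs.1
    have hx : 0 ≤ (1 + s) ^ μ := Real.rpow_nonneg (by linarith) μ
    rw [norm_mul, Complex.norm_real, Real.norm_of_nonneg hx]
    refine le_add_of_nonneg_of_le (by positivity) ?_
    gcongr
    exact hb s ⟨hs.1, hs.2.le⟩

/-- The pairing of a square integrable function with a Schwartz function. -/
def pairingCLM (φ : 𝓢(Space n, ℂ)) : L2 n →L[ℂ] ℂ :=
  (PointwiseConvergenceCLM.evalCLM (RingHom.id ℂ) ℂ φ).comp (Lp.toTemperedDistributionCLM ℂ volume 2)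

lemma pairingCLM_apply (φ : 𝓢(Space n, ℂ)) (f : L2 n) :
    pairingCLM φ f = (f : 𝓢'(Space n, ℂ)) φ := rfl

/-- Cauchy–Schwarz and Plancherel. The pairing is bilinear, so one factor is conjugated to turn it
into an inner product. -/
lemma norm_pairing_le (φ : 𝓢(Space n, ℂ)) (f : L2 n) :
    ‖(f : 𝓢'(Space n, ℂ)) φ‖ ≤ ‖(𝓕⁻ φ).toLp 2 volume‖ * ‖f‖ := by
  have hψ : MemLp (fun η => (𝓕⁻ φ) η) 2 volume := (𝓕⁻ φ).memLp 2
  have hstar : MemLp (fun η => (starRingEnd ℂ) ((𝓕⁻ φ) η)) 2 volume := hψ.star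
  have h1 : (f : 𝓢'(Space n, ℂ)) φ = inner ℂ (hstar.toLp _) (𝓕 f : L2 n) := by
    rw [pairing_eq, L2.inner_def]
    refine integral_congr_ae ?_
    filter_upwards [hstar.coeFn_toLp] with η h
    rw [h]
    simp [mul_comm]
  have h2 : ‖hstar.toLp _‖ = ‖(𝓕⁻ φ).toLp 2 volume‖ := by
    rw [Lp.norm_toLp, SchwartzMap.norm_toLp]
    congr 1
    exact eLpNorm_congr_norm_ae (Eventually.of_forall fun η => by simp)
  rw [h1, ← h2, ← Lp.norm_fourier_eq f]
  exact norm_inner_le_norm _ _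

/-- Functions with frequencies in a ball. -/
def IsBandlimited (R : ℝ) (φ : 𝓢(Space n, ℂ)) : Prop :=
  ∀ η, R < freqNorm η → (𝓕⁻ φ) η = 0

lemma IsBandlimited.laplacian {R : ℝ} {φ : 𝓢(Space n, ℂ)} (h : IsBandlimited R φ) :
    IsBandlimited R (Δ φ) := fun η hη => by rw [fourierInv_laplacian, h η hη, mul_zero]

/-- On band-limited functions the Laplacian is bounded, which allows the wave equation to be
iterated without losing derivatives. -/
lemma IsBandlimited.norm_laplacian_le {R : ℝ} {φ : 𝓢(Space n, ℂ)} (h : IsBandlimited R φ) :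
    ‖(𝓕⁻ (Δ φ)).toLp 2 volume‖ ≤ R ^ 2 * ‖(𝓕⁻ φ).toLp 2 volume‖ := by
  refine Lp.norm_le_mul_norm_of_ae_le_mul ?_
  filter_upwards [(𝓕⁻ (Δ φ)).coeFn_toLp 2, (𝓕⁻ φ).coeFn_toLp 2] with η h1 h2
  rw [h1, h2, fourierInv_laplacian, norm_mul, norm_neg, Complex.norm_real,
    Real.norm_of_nonneg (by positivity)]
  rcases lt_or_ge R (freqNorm η) with hη | hη
  · simp [h η hη]
  · have h0 : 0 ≤ freqNorm η := norm_nonneg _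
    change freqNorm η ^ 2 * _ ≤ _
    gcongr

/-- Transforms of smooth compactly supported functions are band-limited, and pairing with them tests
`𝓕 f` against all such functions. -/
lemma eq_zero_of_pairing_eq_zero {f : L2 n}
    (h : ∀ R, 0 ≤ R → ∀ φ : 𝓢(Space n, ℂ), IsBandlimited R φ → (f : 𝓢'(Space n, ℂ)) φ = 0) :
    f = 0 := by
  have hae : ∀ᵐ η, (𝓕 f : L2 n) η = 0 := by
    refine ae_eq_zero_of_integral_contDiff_smul_eq_zero
      ((Lp.memLp (𝓕 f : L2 n)).locallyIntegrable (by norm_num)) fun g hg hgc => ?_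
    have hsupp : HasCompactSupport fun η => (g η : ℂ) := hgc.comp_left Complex.ofReal_zero
    have hsm : ContDiff ℝ (⊤ : ℕ∞) fun η => (g η : ℂ) := Complex.ofRealCLM.contDiff.comp hg
    let ψ : 𝓢(Space n, ℂ) := hsupp.toSchwartzMap hsm
    have hinv : 𝓕⁻ (𝓕 ψ) = ψ := FourierTransform.fourierInv_fourier_eq ψ
    obtain ⟨R, hR0, hR⟩ := hgc.isCompact.isBounded.exists_pos_norm_le
    have hband : IsBandlimited (2 * Real.pi * R) (𝓕 ψ) := by
      intro η hη
      rw [hinv]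
      have : η ∉ tsupport g := fun hmem => by
        have h1 := hR η hmem
        rw [freqNorm, norm_smul, Real.norm_of_nonneg (by positivity)] at hη
        have : 2 * Real.pi * ‖η‖ ≤ 2 * Real.pi * R := by gcongr
        linarith
      change (g η : ℂ) = 0
      rw [image_eq_zero_of_notMem_tsupport this, Complex.ofReal_zero]
    have := h _ (by positivity) _ hband
    rw [pairing_eq, hinv] at this
    rw [← this]
    refine integral_congr_ae (Eventually.of_forall fun η => ?_)
    change g η • _ = (g η : ℂ) * _
    rw [Complex.real_smul]
  refine fourier_injective (Lp.ext ?_)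
  have hz : (𝓕 (0 : L2 n) : L2 n) = 0 := (Lp.fourierTransformₗᵢ (Space n) ℂ).map_zero
  simp only [hz]
  filter_upwards [hae, Lp.coeFn_zero (E := ℂ) (p := 2) (μ := (volume : Measure (Space n)))]
    with η h1 h2
  rw [h1, h2, Pi.zero_apply]

/-- Solutions of the Cauchy problem are unique. -/
theorem IsSolution.unique {μ : ℝ} (hμ : 0 ≤ μ) {u₁ u₂ : L2 n} {u v u' v' : ℝ → L2 n}
    (h : IsSolution μ u₁ u₂ u v) (h' : IsSolution μ u₁ u₂ u' v') {t : ℝ} (ht : 0 ≤ t) :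
    u t = u' t ∧ v t = v' t := by
  have hd : ∀ t, 0 ≤ t → HasDerivWithinAt (fun t => u t - u' t) (v t - v' t) (Set.Ici 0) t :=
    fun t ht => (h.hasDeriv t ht).sub (h'.hasDeriv t ht)
  have hcont : ContinuousOn (fun t => u t - u' t) (Set.Ici 0) := fun t ht =>
    (hd t ht).continuousWithinAt
  have hH : ∀ φ t, 0 ≤ t → HasDerivWithinAt (fun t => pairingCLM φ (u t - u' t))
      (pairingCLM φ (v t - v' t)) (Set.Ici 0) t := fun φ t ht =>
    ((pairingCLM φ).restrictScalars ℝ).hasFDerivAt.comp_hasDerivWithinAt t (hd t ht)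
  have hK : ∀ φ t, 0 ≤ t → HasDerivWithinAt (fun t => pairingCLM φ (v t - v' t))
      (pairingCLM (Δ φ) (u t - u' t) - ((μ / (1 + t) : ℝ) : ℂ) * pairingCLM φ (v t - v' t))
      (Set.Ici 0) t := by
    intro φ t ht
    have h1 := (h.equation φ t ht).sub (h'.equation φ t ht)
    simp only [map_sub, pairingCLM_apply]
    refine h1.congr_deriv ?_
    rw [TemperedDistribution.laplacian_apply_apply, TemperedDistribution.laplacian_apply_apply]
    ring
  have hzero : ∀ T, 0 ≤ T → u T - u' T = 0 := by
    intro T hT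
    obtain ⟨B, hB⟩ := (isCompact_Icc (a := 0) (b := T)).exists_bound_of_continuousOn
      (hcont.mono fun s hs => hs.1)
    have hB0 : 0 ≤ B := (norm_nonneg _).trans (hB 0 ⟨le_rfl, hT⟩)
    refine eq_zero_of_pairing_eq_zero fun R hR φ hφ => ?_
    -- With H_φ the pairing of the difference with φ, the equation reads H_φ'' + μ/(1+t) H_φ' =
    -- H_{Δφ} with zero data. Each application costs R² and gains two integrations in time, one
    -- damped and one with μ = 0, so the bound gains a factorial and tends to zero.
    have iter : ∀ k : ℕ, ∀ φ : 𝓢(Space n, ℂ), IsBandlimited R φ → ∀ t ∈ Set.Icc 0 T,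
        ‖pairingCLM φ (u t - u' t)‖ ≤
          B * ‖(𝓕⁻ φ).toLp 2 volume‖ * ((R * t) ^ (2 * k) / (2 * k).factorial) := by
      intro k
      induction k with
      | zero =>
        intro φ hφ t ht
        have := norm_pairing_le φ (u t - u' t)
        simp only [mul_zero, pow_zero, Nat.factorial_zero, Nat.cast_one, div_one, mul_one]
        rw [mul_comm B]
        exact this.trans (mul_le_mul_of_nonneg_left (hB t ht) (norm_nonneg _))
      | succ k ih =>
        intro φ hφ t ht
        refine norm_le_of_damped_deriv (μ := 0) (T := T) le_rfl (by positivity) hR (2 * k + 1)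
          (by simp [h.initial_value, h'.initial_value]) (hH φ) ?_ ht
        intro s hs
        simp only [zero_div, Complex.ofReal_zero, zero_mul, add_zero]
        refine norm_le_of_damped_deriv (T := T) hμ (by positivity) hR (2 * k)
          (by simp [h.initial_deriv, h'.initial_deriv]) (hK φ) ?_ hs
        intro r hr
        rw [sub_add_cancel]
        refine (ih (Δ φ) hφ.laplacian r hr).trans ?_
        have hr0 : 0 ≤ r := hr.1
        calc B * ‖(𝓕⁻ (Δ φ)).toLp 2 volume‖ * ((R * r) ^ (2 * k) / (2 * k).factorial)
            ≤ B * (R ^ 2 * ‖(𝓕⁻ φ).toLp 2 volume‖) * ((R * r) ^ (2 * k) / (2 * k).factorial) := by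
              gcongr
              exact hφ.norm_laplacian_le
          _ = _ := by ring
    have hlim : Tendsto (fun k : ℕ => B * ‖(𝓕⁻ φ).toLp 2 volume‖ *
        ((R * T) ^ (2 * k) / (2 * k).factorial)) atTop (𝓝 0) := by
      have h1 := (FloorSemiring.tendsto_pow_div_factorial_atTop (R * T)).comp
        (tendsto_id.const_mul_atTop' (two_pos : (0 : ℕ) < 2))
      simpa using h1.const_mul (B * ‖(𝓕⁻ φ).toLp 2 volume‖)
    have := ge_of_tendsto' hlim fun k => iter k φ hφ T ⟨hT, le_rfl⟩
    exact norm_le_zero_iff.1 this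
  refine ⟨sub_eq_zero.1 (hzero t ht), sub_eq_zero.1 ?_⟩
  have hconst : HasDerivWithinAt (fun t => u t - u' t) 0 (Set.Ici 0) t :=
    (hasDerivWithinAt_const t (Set.Ici 0) (0 : L2 n)).congr hzero (hzero t ht)
  exact (uniqueDiffOn_Ici 0 t ht).eq_deriv _ (hd t ht) hconst

end Uniqueness

/-! ### The energy operators as Fourier multipliers -/

section EnergyOperator

variable {μ κ : ℝ} {Y Y' : Fin 2 → ℝ → ℝ → ℝ} {K : ℝ → Matrix (Fin 2) (Fin 2) ℝ}

lemma japanese_ne_zero (ξ : Space n) : japanese ξ ≠ 0 := (sqrt_one_add_sq_pos ‖ξ‖).ne'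

/-- The operator `𝔼^(κ)(t)` is determined by its defining property. -/
lemma IsEnergyOperator.unique {t : ℝ} {S S' : Pair n →L[ℂ] Pair n}
    (h : IsEnergyOperator μ κ t S) (h' : IsEnergyOperator μ κ t S') : S = S' := by
  ext1 f
  obtain ⟨u₁, u₂, ⟨⟨g, hg, hgf⟩, h2⟩, ⟨u, v, hu⟩, hS⟩ := h f
  obtain ⟨u₁', u₂', ⟨⟨g', hg', hgf'⟩, h2'⟩, -, hS'⟩ := h' f
  obtain rfl := hgf.unique hgf'
  obtain rfl := h2.unique h2'
  obtain rfl := hg.unique_left japanese_ne_zero hg'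
  obtain ⟨e0, e1⟩ := hS u v hu
  obtain ⟨e0', e1'⟩ := hS' u v hu
  funext i
  fin_cases i
  · exact e0.unique e0'
  · exact e1.trans e1'.symm

lemma exists_isMultiplier {m : Space n → ℝ}
    (hm : AEStronglyMeasurable (fun η : Space n => (m ((2 * Real.pi) • η) : ℂ)) volume) {C : ℝ}
    (hC : ∀ᵐ η : Space n, |m ((2 * Real.pi) • η)| ≤ C) (f : L2 n) : ∃ g, IsMultiplier m f g := by
  obtain ⟨T, hT⟩ := exists_mul_clm _ hm (C := C) (hC.mono fun η h => by
    rwa [Complex.norm_real, Real.norm_eq_abs])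
  refine ⟨𝓕⁻ (T (𝓕 f)), ?_⟩
  rw [IsMultiplier, FourierTransform.fourier_fourierInv_eq]
  exact hT (𝓕 f)

lemma aestronglyMeasurable_radial {m : ℝ → ℝ} (hm : Measurable m) :
    AEStronglyMeasurable (fun η : Space n => (m (freqNorm η) : ℂ)) volume :=
  (Complex.measurable_ofReal.comp (hm.comp continuous_freqNorm.measurable)).aestronglyMeasurable

lemma dataWeight_le_one (hκ : 0 ≤ κ) (j : Fin 2) {r : ℝ} (hr : 0 ≤ r) : dataWeight κ j r ≤ 1 := by
  have h : radialBracket r ^ κ ≤ 1 :=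
    Real.rpow_le_one (radialBracket_nonneg hr) (radialBracket_le_one r) hκ
  have h0 : 0 ≤ radialBracket r ^ κ := Real.rpow_nonneg (radialBracket_nonneg hr) κ
  fin_cases j
  · exact (div_le_self h0 (one_le_sqrt_one_add_sq r)).trans h
  · exact h

/-- The data belonging to a pair of square integrable functions. -/
lemma exists_isData (hκ : 0 ≤ κ) (f : Pair n) : ∃ u₁ u₂ g₁ : L2 n, IsData κ f u₁ u₂ ∧
    IsMultiplier japanese u₁ g₁ ∧ IsMultiplier (fun ξ => dataWeight κ 0 ‖ξ‖) (f 0) u₁ ∧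
    IsMultiplier (fun ξ => dataWeight κ 1 ‖ξ‖) (f 1) u₂ := by
  have hex : ∀ j (f : L2 n), ∃ g, IsMultiplier (fun ξ => dataWeight κ j ‖ξ‖) f g := fun j f =>
    exists_isMultiplier (aestronglyMeasurable_radial (measurable_dataWeight κ j)) (C := 1)
      (Eventually.of_forall fun η => by
        rw [abs_of_nonneg (dataWeight_nonneg κ j (norm_nonneg _))]
        exact dataWeight_le_one hκ j (norm_nonneg _)) f
  obtain ⟨u₁, hu₁⟩ := hex 0 (f 0)
  -- The second weight is [·]^κ itself, so applied to f₀ it gives ⟨D⟩u₁.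
  obtain ⟨g₁, hg₁⟩ := hex 1 (f 0)
  obtain ⟨u₂, hu₂⟩ := hex 1 (f 1)
  have hj : IsMultiplier japanese u₁ g₁ := by
    filter_upwards [hu₁, hg₁] with η h1 h2
    rw [h1, h2, ← mul_assoc, japanese_smul, ← Complex.ofReal_mul]
    congr 2
    exact (mul_div_cancel₀ _ (sqrt_one_add_sq_pos _).ne').symm
  exact ⟨u₁, u₂, g₁, ⟨⟨g₁, hj, hg₁⟩, hu₂⟩, hj, hu₁, hu₂⟩

/-- The symbol of the energy operator. -/
def energySymbol (κ : ℝ) (Y Y' : Fin 2 → ℝ → ℝ → ℝ) (t : ℝ) (ξ : Space n) :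
    Matrix (Fin 2) (Fin 2) ℂ :=
  Matrix.of fun i j => ((![‖ξ‖ * Y j ‖ξ‖ t, Y' j ‖ξ‖ t] i * dataWeight κ j ‖ξ‖ : ℝ) : ℂ)

lemma energySymbol_smul (κ : ℝ) (Y Y' : Fin 2 → ℝ → ℝ → ℝ) (t : ℝ) (η : Space n) (i j : Fin 2) :
    energySymbol κ Y Y' t ((2 * Real.pi) • η) i j = ((![freqNorm η * Y j (freqNorm η) t,
      Y' j (freqNorm η) t] i * dataWeight κ j (freqNorm η) : ℝ) : ℂ) := rfl

/-- By uniqueness, the requirement on all solutions need only be checked on the one obtained by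
superposition. -/
lemma isEnergyOperator_of_hasSymbol (hn : 1 ≤ n) (hμ : 0 ≤ μ) (hκ : 0 ≤ κ)
    (hY : IsFundamental μ Y Y') {t : ℝ} (ht : 0 ≤ t) {S : Pair n →L[ℂ] Pair n}
    (hS : HasSymbol S (energySymbol κ Y Y' t)) : IsEnergyOperator μ κ t S := by
  intro f
  obtain ⟨u₁, u₂, g₁, hdata, hg₁, hu₁, hu₂⟩ := exists_isData hκ f
  obtain ⟨u, v, huv, hfreq⟩ := exists_isSolution hn hμ hY (u₂ := u₂) hg₁
  refine ⟨u₁, u₂, hdata, ⟨u, v, huv⟩, fun u' v' huv' => ?_⟩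
  obtain ⟨e1, e2⟩ := huv'.unique hμ huv ht
  obtain ⟨f1, f2⟩ := hfreq t ht
  rw [e1, e2]
  constructor
  · filter_upwards [hS f 0, f1, hu₁, hu₂] with η h1 h2 h3 h4
    rw [h1, h2, superpose, h3, h4]
    simp only [Fin.sum_univ_two, energySymbol_smul, Matrix.cons_val_zero, freqNorm]
    push_cast
    ring
  · refine fourier_injective (Lp.ext ?_)
    filter_upwards [hS f 1, f2, hu₁, hu₂] with η h1 h2 h3 h4
    rw [h1, h2, superpose, h3, h4]
    simp only [Fin.sum_univ_two, energySymbol_smul, Matrix.cons_val_one, freqNorm]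
    push_cast
    ring

/-- Boundedness of the symbol follows from the uniform decay bound because (1+t)^(μ/2) ≥ 1. -/
lemma exists_hasSymbol_energySymbol (hn : 1 ≤ n) (hμ : 0 ≤ μ) (hY : IsFundamental μ Y Y')
    (hK : IsLimitSymbol μ Y Y' K) {t : ℝ} (ht : 0 ≤ t) :
    ∃ S : Pair n →L[ℂ] Pair n, HasSymbol S (energySymbol ((μ - 2) / 2) Y Y' t) := by
  obtain ⟨C, hC⟩ := hK.bound
  refine exists_hasSymbol _ (fun i j => ?_) (C := C) fun i j => ?_
  · simp only [energySymbol_smul]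
    refine aestronglyMeasurable_radial (m := fun r => ![r * Y j r t, Y' j r t] i *
      dataWeight ((μ - 2) / 2) j r) (Measurable.mul ?_ (measurable_dataWeight _ j))
    fin_cases i
    exacts [measurable_id.mul (hY.measurable j t), hY.measurable_deriv j t]
  · filter_upwards [ae_freqNorm_pos hn] with η hη
    have hx : 1 ≤ (1 + t) ^ (μ / 2) := Real.one_le_rpow (by linarith) (by linarith)
    have habs : ∀ y d : ℝ, |(1 + t) ^ (μ / 2) * y * d| ≤ C → |y * d| ≤ C := fun y d h => by
      rw [mul_assoc, abs_mul, abs_of_nonneg (by linarith)] at h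
      exact (le_mul_of_one_le_left (abs_nonneg _) hx).trans h
    rw [energySymbol_smul, Complex.norm_real, Real.norm_eq_abs]
    have := hC j _ t hη ht
    fin_cases i
    · exact habs _ _ this.1
    · exact habs _ _ this.2

end EnergyOperator

/-! ### The strong limit, its uniqueness and its action at high frequencies -/

section Limit

variable {μ : ℝ} {Y Y' : Fin 2 → ℝ → ℝ → ℝ} {K : ℝ → Matrix (Fin 2) (Fin 2) ℝ}

lemma exists_hasSymbol_freeSymbol (t : ℝ) : ∃ U : Pair n →L[ℂ] Pair n, HasSymbol U (freeSymbol t) := by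
  have hcos : Continuous fun η : Space n => (Real.cos (t * freqNorm η) : ℂ) :=
    Complex.continuous_ofReal.comp
      (Real.continuous_cos.comp (continuous_const.mul continuous_freqNorm))
  have hsin : Continuous fun η : Space n => (Real.sin (t * freqNorm η) : ℂ) :=
    Complex.continuous_ofReal.comp
      (Real.continuous_sin.comp (continuous_const.mul continuous_freqNorm))
  refine exists_hasSymbol _ (fun i j => ?_) (C := 1) fun i j => Eventually.of_forall fun η => ?_
  · fin_cases i <;> fin_cases j
    exacts [hcos.aestronglyMeasurable, hsin.aestronglyMeasurable,
      hsin.neg.aestronglyMeasurable, hcos.aestronglyMeasurable]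
  · have h1 := Real.abs_cos_le_one (t * ‖(2 * Real.pi) • η‖)
    have h2 := Real.abs_sin_le_one (t * ‖(2 * Real.pi) • η‖)
    rw [← Real.norm_eq_abs, ← Complex.norm_real] at h1 h2
    fin_cases i <;> fin_cases j
    exacts [h1, h2, (norm_neg _).trans_le h2, h1]

lemma freeSymbol_smul (t : ℝ) (η : Space n) : freeSymbol t ((2 * Real.pi) • η) =
    !![(Real.cos (t * freqNorm η) : ℂ), (Real.sin (t * freqNorm η) : ℂ);
      -(Real.sin (t * freqNorm η) : ℂ), (Real.cos (t * freqNorm η) : ℂ)] := rfl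

/-- The symbol of `(1 + t)^{μ/2} ℰ₀(-t) 𝔼^(κ)(t)` as a function of `|ξ|`. -/
def rotatedSymbol (μ : ℝ) (Y Y' : Fin 2 → ℝ → ℝ → ℝ) (t r : ℝ) : Matrix (Fin 2) (Fin 2) ℝ :=
  Matrix.of fun i j =>
    ![Real.cos (t * r) * ((1 + t) ^ (μ / 2) * (r * Y j r t) * dataWeight ((μ - 2) / 2) j r) -
      Real.sin (t * r) * ((1 + t) ^ (μ / 2) * Y' j r t * dataWeight ((μ - 2) / 2) j r),
      Real.sin (t * r) * ((1 + t) ^ (μ / 2) * (r * Y j r t) * dataWeight ((μ - 2) / 2) j r) +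
      Real.cos (t * r) * ((1 + t) ^ (μ / 2) * Y' j r t * dataWeight ((μ - 2) / 2) j r)] i

lemma IsLimitSymbol.tendsto_rotatedSymbol (hK : IsLimitSymbol μ Y Y' K) (i j : Fin 2) {r : ℝ}
    (hr : 0 < r) : Tendsto (fun t => rotatedSymbol μ Y Y' t r i j) atTop (𝓝 (K r i j)) := by
  fin_cases i
  · exact hK.tendsto_fst j r hr
  · exact hK.tendsto_snd j r hr

lemma IsLimitSymbol.exists_abs_rotatedSymbol_le (hK : IsLimitSymbol μ Y Y' K) :
    ∃ C, ∀ i j r t, 0 < r → 0 ≤ t → |rotatedSymbol μ Y Y' t r i j| ≤ C := by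
  obtain ⟨C, hC⟩ := hK.bound
  refine ⟨C + C, fun i j r t hr ht => ?_⟩
  obtain ⟨h1, h2⟩ := hC j r t hr ht
  have hc := Real.abs_cos_le_one (t * r)
  have hs := Real.abs_sin_le_one (t * r)
  have hmul : ∀ x y : ℝ, |x| ≤ 1 → |y| ≤ C → |x * y| ≤ C := fun x y hx hy => by
    rw [abs_mul]; exact (mul_le_of_le_one_left (abs_nonneg y) hx).trans hy
  fin_cases i
  · exact (abs_sub _ _).trans (add_le_add (hmul _ _ hc h1) (hmul _ _ hs h2))
  · exact (abs_add_le _ _).trans (add_le_add (hmul _ _ hs h1) (hmul _ _ hc h2))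

/-- The limit symbol as a function of the frequency. -/
def limitSymbol (K : ℝ → Matrix (Fin 2) (Fin 2) ℝ) (ξ : Space n) : Matrix (Fin 2) (Fin 2) ℂ :=
  Matrix.of fun i j => (K ‖ξ‖ i j : ℂ)

lemma IsLimitSymbol.continuousOn_limitSymbol (hK : IsLimitSymbol μ Y Y' K) :
    ContinuousOn (limitSymbol (n := n) K) {0}ᶜ := by
  refine continuousOn_pi.2 fun i => continuousOn_pi.2 fun j => ?_
  refine Complex.continuous_ofReal.comp_continuousOn
    ((hK.continuousOn i j).comp continuous_norm.continuousOn fun ξ hξ => ?_)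
  exact norm_pos_iff.2 hξ

lemma IsLimitSymbol.tendsto_limitSymbol (hK : IsLimitSymbol μ Y Y' K) :
    Tendsto (limitSymbol (n := n) K) (Bornology.cobounded (Space n)) (𝓝 1) := by
  refine tendsto_pi_nhds.2 fun i => tendsto_pi_nhds.2 fun j => ?_
  have h := (Complex.continuous_ofReal.tendsto _).comp
    ((hK.tendsto_one i j).comp (tendsto_norm_cobounded_atTop (E := Space n)))
  have h1 : (((1 : Matrix (Fin 2) (Fin 2) ℝ) i j : ℝ) : ℂ) =
      (1 : Matrix (Fin 2) (Fin 2) ℂ) i j := by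
    simp only [Matrix.one_apply]
    split_ifs <;> simp
  rw [h1] at h
  exact h

lemma IsLimitSymbol.exists_hasSymbol_limitSymbol (hn : 1 ≤ n) (hK : IsLimitSymbol μ Y Y' K) :
    ∃ Z : Pair n →L[ℂ] Pair n, HasSymbol Z (limitSymbol K) := by
  obtain ⟨C, hC⟩ := hK.exists_abs_rotatedSymbol_le
  refine exists_hasSymbol _ (fun i j => ?_) (C := C) fun i j => ?_
  · have hmem : ∀ᵐ η : Space n, η ∈ {η : Space n | 0 < freqNorm η} := ae_freqNorm_pos hn
    rw [← Measure.restrict_eq_self_of_ae_mem hmem]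
    refine ContinuousOn.aestronglyMeasurable ?_
      (measurableSet_lt measurable_const continuous_freqNorm.measurable)
    exact Complex.continuous_ofReal.comp_continuousOn
      ((hK.continuousOn i j).comp continuous_freqNorm.continuousOn fun ξ hξ => hξ)
  · filter_upwards [ae_freqNorm_pos hn] with η hη
    change ‖((K (freqNorm η) i j : ℝ) : ℂ)‖ ≤ C
    rw [Complex.norm_real]
    refine le_of_tendsto (hK.tendsto_rotatedSymbol i j hη).norm ?_
    filter_upwards [eventually_ge_atTop 0] with t ht
    exact hC i j _ t hη ht

/-- Strong convergence to the operator with the limit symbol. -/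
theorem IsLimitSymbol.isZPlus (hn : 1 ≤ n) (hμ : 2 ≤ μ) (hY : IsFundamental μ Y Y')
    (hK : IsLimitSymbol μ Y Y' K) {Z : Pair n →L[ℂ] Pair n} (hZ : HasSymbol Z (limitSymbol K)) :
    IsZPlus μ Z := by
  have hS : ∀ t : ℝ, ∃ S : Pair n →L[ℂ] Pair n,
      0 ≤ t → HasSymbol S (energySymbol ((μ - 2) / 2) Y Y' t) := fun t => by
    by_cases ht : 0 ≤ t
    · obtain ⟨S, hS⟩ := exists_hasSymbol_energySymbol hn (by linarith) hY hK ht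
      exact ⟨S, fun _ => hS⟩
    · exact ⟨0, fun h => absurd h ht⟩
  choose S hS using hS
  choose U hU using exists_hasSymbol_freeSymbol (n := n)
  refine ⟨S, U, fun t ht => isEnergyOperator_of_hasSymbol hn (by linarith) (by linarith) hY ht
    (hS t ht), hU, fun f => tendsto_pi_nhds.2 fun i => ?_⟩
  obtain ⟨C, hC⟩ := hK.exists_abs_rotatedSymbol_le
  have key : Tendsto (fun t : ℝ =>
      (𝓕 (((((1 + t) ^ (μ / 2) : ℝ) : ℂ) • U (-t) (S t f)) i) : L2 n)) atTop
      (𝓝 (𝓕 (Z f i) : L2 n)) := by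
    refine tendsto_L2_of_dominated
      (f := fun t η => ∑ j, (rotatedSymbol μ Y Y' t (freqNorm η) i j : ℂ) * (𝓕 (f j) : L2 n) η)
      (g := fun η => C * ‖(𝓕 (f 0) : L2 n) η‖ + C * ‖(𝓕 (f 1) : L2 n) η‖) ?_ (hZ f i) ?_ ?_ ?_
    · filter_upwards [eventually_ge_atTop 0] with t ht
      have hsmul : (𝓕 (((((1 + t) ^ (μ / 2) : ℝ) : ℂ) • U (-t) (S t f)) i) : L2 n) =
          (((1 + t) ^ (μ / 2) : ℝ) : ℂ) • (𝓕 (U (-t) (S t f) i) : L2 n) :=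
        (Lp.fourierTransformₗᵢ (Space n) ℂ).map_smul _ _
      rw [hsmul]
      filter_upwards [Lp.coeFn_smul (((1 + t) ^ (μ / 2) : ℝ) : ℂ) (𝓕 (U (-t) (S t f) i) : L2 n),
        hU (-t) (S t f) i, hS t ht f 0, hS t ht f 1] with η h1 h2 h3 h4
      rw [h1, Pi.smul_apply, h2, Fin.sum_univ_two, h3, h4]
      simp only [Fin.sum_univ_two, energySymbol_smul, freeSymbol_smul, smul_eq_mul]
      fin_cases i
      · simp [rotatedSymbol]
        ring
      · simp [rotatedSymbol]
        ring
    · exact ((Lp.memLp (𝓕 (f 0) : L2 n)).norm.const_mul C).add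
        ((Lp.memLp (𝓕 (f 1) : L2 n)).norm.const_mul C)
    · filter_upwards [eventually_ge_atTop 0] with t ht
      filter_upwards [ae_freqNorm_pos hn] with η hη
      rw [Fin.sum_univ_two]
      refine (norm_add_le _ _).trans ?_
      rw [norm_mul, norm_mul, Complex.norm_real, Complex.norm_real]
      gcongr
      · exact hC i 0 _ t hη ht
      · exact hC i 1 _ t hη ht
    · filter_upwards [ae_freqNorm_pos hn] with η hη
      refine tendsto_finsetSum _ fun j _ => ?_
      exact ((Complex.continuous_ofReal.tendsto _).comp
        (hK.tendsto_rotatedSymbol i j hη)).mul_const _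
  have := ((Lp.fourierTransformₗᵢ (Space n) ℂ).symm.continuous.tendsto _).comp key
  change Tendsto (fun t => (Lp.fourierTransformₗᵢ (Space n) ℂ).symm
    ((Lp.fourierTransformₗᵢ (Space n) ℂ) _)) atTop
    (𝓝 ((Lp.fourierTransformₗᵢ (Space n) ℂ).symm ((Lp.fourierTransformₗᵢ (Space n) ℂ) _))) at this
  simpa only [LinearIsometryEquiv.symm_apply_apply] using this

/-- The operator `Z₊` is unique. -/
theorem IsZPlus.unique {Z Z' : Pair n →L[ℂ] Pair n} (h : IsZPlus μ Z) (h' : IsZPlus μ Z') :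
    Z = Z' := by
  obtain ⟨S, U, hS, hU, hlim⟩ := h
  obtain ⟨S', U', hS', hU', hlim'⟩ := h'
  ext1 f
  refine tendsto_nhds_unique (hlim f) ((hlim' f).congr' ?_)
  filter_upwards [eventually_ge_atTop 0] with t ht
  rw [(hU (-t)).unique (hU' (-t)), (hS t ht).unique (hS' t ht)]

/-- An operator whose symbol tends to the identity almost preserves high frequencies. -/
theorem HasSymbol.almost_preserves {Z : Pair n →L[ℂ] Pair n}
    {M : Space n → Matrix (Fin 2) (Fin 2) ℂ} (hZ : HasSymbol Z M)
    (hM : Tendsto M (Bornology.cobounded (Space n)) (𝓝 1)) {ε : ℝ} (hε : 0 < ε) :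
    ∃ R : ℝ, ∀ f : Pair n, (∀ j : Fin 2, ∀ᵐ η : Space n, ‖(2 * Real.pi) • η‖ < R →
      (𝓕 (f j) : L2 n) η = 0) → ‖Z f - f‖ ≤ ε * ‖f‖ := by
  -- Each row has two entries and the norm on pairs is the maximum, so ε/2 per entry suffices.
  have hev : ∀ᶠ ξ in Bornology.cobounded (Space n), ∀ i j,
      ‖M ξ i j - (1 : Matrix (Fin 2) (Fin 2) ℂ) i j‖ ≤ ε / 2 := by
    refine eventually_all.2 fun i => eventually_all.2 fun j => ?_
    have h := tendsto_pi_nhds.1 (tendsto_pi_nhds.1 hM i) j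
    filter_upwards [(tendsto_iff_norm_sub_tendsto_zero.1 h).eventually
      (gt_mem_nhds (half_pos hε))] with ξ hξ
    exact hξ.le
  obtain ⟨R, hR⟩ : ∃ R : ℝ, ∀ ξ : Space n, R ≤ ‖ξ‖ → ∀ i j,
      ‖M ξ i j - (1 : Matrix (Fin 2) (Fin 2) ℂ) i j‖ ≤ ε / 2 := by
    rw [← comap_norm_atTop, eventually_comap] at hev
    obtain ⟨R, hR⟩ := eventually_atTop.1 hev
    exact ⟨R, fun ξ hξ => hR _ hξ ξ rfl⟩
  refine ⟨R, fun f hf => ?_⟩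
  refine (pi_norm_le_iff_of_nonneg (by positivity)).2 fun i => ?_
  have hmem : ∀ j, MemLp (fun η => ‖(𝓕 (f j) : L2 n) η‖) 2 volume := fun j =>
    (Lp.memLp (𝓕 (f j) : L2 n)).norm
  have hnorm : ∀ j, ‖(hmem j).toLp _‖ ≤ ‖f‖ := fun j => by
    refine le_trans (le_of_eq ?_) (norm_le_pi_norm f j)
    rw [← Lp.norm_fourier_eq (f j), Lp.norm_toLp, eLpNorm_norm, Lp.norm_def]
  have hle : ‖(𝓕 ((Z f - f) i) : L2 n)‖ ≤
      ε / 2 * ‖(hmem 0).toLp _ + (hmem 1).toLp _‖ := by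
    refine Lp.norm_le_mul_norm_of_ae_le_mul ?_
    have hsub : (𝓕 ((Z f - f) i) : L2 n) = 𝓕 (Z f i) - 𝓕 (f i) :=
      (Lp.fourierTransformₗᵢ (Space n) ℂ).map_sub _ _
    rw [hsub]
    filter_upwards [Lp.coeFn_sub (𝓕 (Z f i) : L2 n) (𝓕 (f i)), hZ f i, hf 0, hf 1,
      Lp.coeFn_add ((hmem 0).toLp _) ((hmem 1).toLp _), (hmem 0).coeFn_toLp,
      (hmem 1).coeFn_toLp] with η h1 h2 h3 h4 h5 h6 h7
    rw [h1, h5, Pi.add_apply, h6, h7, Pi.sub_apply, h2, Fin.sum_univ_two,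
      Real.norm_of_nonneg (by positivity)]
    rcases lt_or_ge ‖(2 * Real.pi) • η‖ R with hη | hη
    · have hi : (𝓕 (f i) : L2 n) η = 0 := by
        fin_cases i
        exacts [h3 hη, h4 hη]
      rw [h3 hη, h4 hη, hi]
      simp
    · have hone : (𝓕 (f i) : L2 n) η = (1 : Matrix (Fin 2) (Fin 2) ℂ) i 0 * (𝓕 (f 0) : L2 n) η +
          (1 : Matrix (Fin 2) (Fin 2) ℂ) i 1 * (𝓕 (f 1) : L2 n) η := by
        have h : ∀ (k : Fin 2) (x : Fin 2 → ℂ), x k = (1 : Matrix (Fin 2) (Fin 2) ℂ) k 0 * x 0 +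
            (1 : Matrix (Fin 2) (Fin 2) ℂ) k 1 * x 1 := Fin.forall_fin_two.2
            ⟨fun x => by simp, fun x => by simp⟩
        exact h i fun j => (𝓕 (f j) : L2 n) η
      rw [hone, add_sub_add_comm, ← sub_mul, ← sub_mul, mul_add]
      refine (norm_add_le _ _).trans ?_
      rw [norm_mul, norm_mul]
      gcongr
      · exact hR _ hη i 0
      · exact hR _ hη i 1
  rw [Lp.norm_fourier_eq] at hle
  calc ‖(Z f - f) i‖ ≤ ε / 2 * (‖f‖ + ‖f‖) := by
        refine hle.trans ?_
        gcongr
        exact (norm_add_le _ _).trans (add_le_add (hnorm 0) (hnorm 1))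
    _ = ε * ‖f‖ := by ring

end Limit

end DissipativeWave

end

theorem mainTheorem5 (n : ℕ) (hn : 1 ≤ n) (μ : ℝ) (hμ : 2 ≤ μ) :
    (∃! Z : DissipativeWave.Pair n →L[ℂ] DissipativeWave.Pair n, DissipativeWave.IsZPlus μ Z) ∧
    ∀ Z : DissipativeWave.Pair n →L[ℂ] DissipativeWave.Pair n, DissipativeWave.IsZPlus μ Z →
      (∃ M : DissipativeWave.Space n → Matrix (Fin 2) (Fin 2) ℂ,
        ContinuousOn M {0}ᶜ ∧ DissipativeWave.HasSymbol Z M) ∧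
      (∀ M : DissipativeWave.Space n → Matrix (Fin 2) (Fin 2) ℂ,
        ContinuousOn M {0}ᶜ → DissipativeWave.HasSymbol Z M →
          Tendsto M (Bornology.cobounded (DissipativeWave.Space n)) (𝓝 1) ∧
          (μ = 2 → ∀ ξ : DissipativeWave.Space n, ξ ≠ 0 →
            M ξ = !![(DissipativeWave.bracket ξ : ℂ), 0;
                     ((DissipativeWave.japanese ξ)⁻¹ : ℂ), 1])) ∧
      (∀ ε : ℝ, 0 < ε → ∃ R : ℝ, ∀ f : DissipativeWave.Pair n,
        (∀ j : Fin 2, ∀ᵐ η : DissipativeWave.Space n, ‖(2 * Real.pi) • η‖ < R →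
          (𝓕 (f j) : DissipativeWave.L2 n) η = 0) →
        ‖Z f - f‖ ≤ ε * ‖f‖) := by
  obtain ⟨Y, Y', K, hY, hK⟩ := DissipativeWave.exists_isFundamental hμ
  obtain ⟨Z₀, hZ₀⟩ := hK.exists_hasSymbol_limitSymbol hn
  have hZ₀' := hK.isZPlus hn hμ hY hZ₀
  refine ⟨⟨Z₀, hZ₀', fun Z hZ => hZ.unique hZ₀'⟩, fun Z hZ => ?_⟩
  obtain rfl := hZ.unique hZ₀'
  refine ⟨⟨_, hK.continuousOn_limitSymbol, hZ₀⟩, fun M hM hMZ => ?_, fun ε hε =>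
    hZ₀.almost_preserves hK.tendsto_limitSymbol hε⟩
  -- Any continuous symbol agrees with the computed one off the origin, so its limit and its value
  -- for μ = 2 can be read off from `limitSymbol`.
  have heq := hMZ.eqOn hZ₀ hM hK.continuousOn_limitSymbol
  refine ⟨hK.tendsto_limitSymbol.congr' ?_, fun h2 ξ hξ => ?_⟩
  · filter_upwards [Bornology.eventually_ne_cobounded 0] with ξ hξ
    exact (heq hξ).symm
  · rw [heq hξ]
    ext i j
    simp only [DissipativeWave.limitSymbol, hK.eq_of_two h2 _ (norm_pos_iff.2 hξ)]
    fin_cases i <;> fin_cases j <;>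
      simp [DissipativeWave.bracket, DissipativeWave.japanese, DissipativeWave.radialBracket]
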